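/- Let $Z$ be a locally compact Hausdorff space and let $(z_n)_{n\in\mathbf N}$ be a sequence of non-isolated points of $Z$ whose range is dense in $Z$. Put $$R=\{(z,(i,j))\in Z\times(\mathbf N\times\mathbf N) : i=j \text{ if } z\in\{z_i,z_j\}\}.$$ 1. $R$ is open in $Z\times(\mathbf N\times\mathbf N)$. The map $(z,(i,j))\mapsto((z,i),(z,j))$ is a homeomorphism of $R$ onto the graph of an equivalence relation on $X=Z\times\mathbf N$ (graph with the topology induced by $X\times X$), and this equivalence relation is étale: its range and source maps $(x,y)\mapsto x$ and $(x,y)\mapsto y$ are local homeomorphisms. 2. The quotient space $Y=X/R$ is the set $Z\sqcup\mathbf N$, with quotient map $X\to Y$ sending $(z,i)$ to $z$ if $z\ne z_i$ and to $i$ if $z=z_i$. A base of its topology is given by the sets $(U\setminus\{z_i : i\in F\})\cup F$, where $U\subseteq Z$ is open and $F\subset\mathbf N$ is a finite set with $z_i\in U$ for all $i\in F$. The space $Y$ is locally compact, in the sense that every point has a compact Hausdorff neighbourhood. The set of Hausdorff points of $Y$ (the points that can be separated by disjoint open neighbourhoods from every other point of $Y$) is $Z\setminus\{z_i : i\in\mathbf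 N\}$, and it has empty interior in $Y$. 3. Let $C^*(R)$ be the (full) C$^*$-algebra of $R$. It is a CCR algebra, i.e. every irreducible representation of it is by compact operators, and its spectrum (the set of unitary equivalence classes of irreducible representations, with the hull-kernel topology) is homeomorphic to $Y$. If $Z$ is moreover second countable, then $C^*(R)$ is separable. -/

import Mathlib

open Set Filter Topology

universe u

/-! ### Étale equivalence relations and their convolution algebras -/

section EtaleRelation

variable {X : Type u} [TopologicalSpace X]

/-- The graph of an equivalence relation on `X`, with the topology induced by `X × X`.  It is a
principal topological groupoid over `X` with range map `(x, y) ↦ x`, source map `(x, y) ↦ y`,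
product `(x, y) (y, w) = (x, w)` and inverse `(x, y)⁻¹ = (y, x)`; the product and the inverse are
automatically continuous. -/
abbrev RelGraph (r : Setoid X) : Type u := {p : X × X // r p.1 p.2}

/-- The equivalence relation `r`, with the topology of `X × X` on its graph, is étale: the range
and source maps are local homeomorphisms. -/
structure IsEtaleRel (r : Setoid X) : Prop where
  range_isLocalHomeomorph : IsLocalHomeomorph (fun γ : RelGraph r => γ.1.1)
  source_isLocalHomeomorph : IsLocalHomeomorph (fun γ : RelGraph r => γ.1.2)

/-- The vector space `C_c(R)` of compactly supported continuous complex functions on the graph of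
an étale equivalence relation (a type of its own, since its product will be the convolution). -/
structure ConvAlg (r : Setoid X) (hr : IsEtaleRel r) : Type u where
  toFun : RelGraph r → ℂ
  continuous_toFun : Continuous toFun
  hasCompactSupport_toFun : HasCompactSupport toFun

namespace ConvAlg

variable {r : Setoid X} {hr : IsEtaleRel r}

open Classical in
/-- The matrix coefficients of `f ∈ C_c(R)`: `f` extended by zero from the graph to `X × X`. -/
noncomputable def coeff (f : ConvAlg r hr) (x y : X) : ℂ :=
  if h : r x y then f.toFun ⟨(x, y), h⟩ else 0

lemma coeff_of_rel (f : ConvAlg r hr) {x y : X} (h : r x y) :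
    f.coeff x y = f.toFun ⟨(x, y), h⟩ := dif_pos h

lemma coeff_of_not_rel (f : ConvAlg r hr) {x y : X} (h : ¬ r x y) : f.coeff x y = 0 := dif_neg h

lemma rel_of_coeff_ne {f : ConvAlg r hr} {x y : X} (h : f.coeff x y ≠ 0) : r x y := by
  by_contra h'
  exact h (f.coeff_of_not_rel h')

lemma toFun_eq (f : ConvAlg r hr) (γ : RelGraph r) : f.toFun γ = f.coeff γ.1.1 γ.1.2 :=
  (f.coeff_of_rel γ.2).symm

lemma ext_coeff {f g : ConvAlg r hr} (h : ∀ x y, f.coeff x y = g.coeff x y) : f = g := by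
  obtain ⟨f, _, _⟩ := f
  obtain ⟨g, _, _⟩ := g
  congr 1
  funext γ
  have := h γ.1.1 γ.1.2
  rwa [coeff_of_rel _ γ.2, coeff_of_rel _ γ.2] at this

instance : Zero (ConvAlg r hr) := ⟨⟨0, continuous_zero, HasCompactSupport.zero⟩⟩
instance : Add (ConvAlg r hr) := ⟨fun f g =>
  ⟨f.toFun + g.toFun, f.2.add g.2, f.3.add g.3⟩⟩
instance : Neg (ConvAlg r hr) := ⟨fun f =>
  ⟨-f.toFun, f.2.neg, f.3.neg⟩⟩
instance : SMul ℂ (ConvAlg r hr) := ⟨fun c f =>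
  ⟨c • f.toFun, f.2.const_smul c, f.3.smul_left (f := fun _ => c)⟩⟩

/-- The involution `f^*(γ) = conj (f(γ⁻¹))`. -/
instance : Star (ConvAlg r hr) := ⟨fun f =>
  ⟨fun γ => star (f.toFun ⟨(γ.1.2, γ.1.1), r.symm γ.2⟩),
    by have := f.2; fun_prop,
    by
      let e : RelGraph r ≃ₜ RelGraph r :=
        { toFun := fun γ => ⟨(γ.1.2, γ.1.1), r.symm γ.2⟩
          invFun := fun γ => ⟨(γ.1.2, γ.1.1), r.symm γ.2⟩
          left_inv := fun γ => rfl
          right_inv := fun γ => rfl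
          continuous_toFun := by fun_prop
          continuous_invFun := by fun_prop }
      exact (f.3.comp_homeomorph e).comp_left (g := fun w : ℂ => star w) (star_zero ℂ)⟩⟩

@[simp] lemma coeff_zero (x y : X) : (0 : ConvAlg r hr).coeff x y = 0 := by
  by_cases h : r x y
  · rw [coeff_of_rel _ h]; rfl
  · rw [coeff_of_not_rel _ h]

@[simp] lemma coeff_add (f g : ConvAlg r hr) (x y : X) :
    (f + g).coeff x y = f.coeff x y + g.coeff x y := by
  by_cases h : r x y
  · simp only [coeff_of_rel _ h]; rfl
  · simp [coeff_of_not_rel _ h]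

@[simp] lemma coeff_neg (f : ConvAlg r hr) (x y : X) : (-f).coeff x y = -f.coeff x y := by
  by_cases h : r x y
  · simp only [coeff_of_rel _ h]; rfl
  · simp [coeff_of_not_rel _ h]

@[simp] lemma coeff_smul (c : ℂ) (f : ConvAlg r hr) (x y : X) :
    (c • f).coeff x y = c * f.coeff x y := by
  by_cases h : r x y
  · simp only [coeff_of_rel _ h]; rfl
  · simp [coeff_of_not_rel _ h]

@[simp] lemma coeff_star (f : ConvAlg r hr) (x y : X) :
    (star f).coeff x y = star (f.coeff y x) := by
  by_cases h : r x y
  · rw [coeff_of_rel _ h, coeff_of_rel _ (r.symm h)]; rfl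
  · have h' : ¬ r y x := fun h' => h (r.symm h')
    simp [coeff_of_not_rel _ h, coeff_of_not_rel _ h']

instance : AddCommGroup (ConvAlg r hr) where
  add_assoc f g h := ext_coeff fun x y => by simp [add_assoc]
  zero_add f := ext_coeff fun x y => by simp
  add_zero f := ext_coeff fun x y => by simp
  add_comm f g := ext_coeff fun x y => by simp [add_comm]
  neg_add_cancel f := ext_coeff fun x y => by simp
  nsmul := nsmulRec
  zsmul := zsmulRec

instance : Module ℂ (ConvAlg r hr) where
  one_smul f := ext_coeff fun x y => by simp
  mul_smul a b f := ext_coeff fun x y => by simp [mul_assoc]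
  smul_zero a := ext_coeff fun x y => by simp
  smul_add a f g := ext_coeff fun x y => by simp [mul_add]
  add_smul a b f := ext_coeff fun x y => by simp [add_mul]
  zero_smul f := ext_coeff fun x y => by simp

/-- The convolution `(f * g)(x, y) = ∑_{w ∼ x} f(x, w) g(w, y)`, a finite sum. -/
noncomputable def convFun (f g : ConvAlg r hr) (x y : X) : ℂ :=
  ∑ᶠ w : X, f.coeff x w * g.coeff w y

lemma convFun_eq_sum (f g : ConvAlg r hr) (x y : X) (A : Finset X)
    (hA : ∀ w, f.coeff x w ≠ 0 → w ∈ A) :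
    convFun f g x y = ∑ w ∈ A, f.coeff x w * g.coeff w y := by
  refine finsum_eq_sum_of_support_subset _ fun w hw => hA w fun h => hw ?_
  simp [h]

variable [T2Space X]

/-- Near `x₀`, the support of `f` in the range fibres is carried by finitely many continuous local
sections of the range map. -/
lemma exists_sections (f : ConvAlg r hr) (x₀ : X) :
    ∃ (S : Finset (RelGraph r)) (σ : RelGraph r → X → RelGraph r) (W : Set X),
      W ∈ 𝓝 x₀ ∧ (∀ s ∈ S, ContinuousOn (σ s) W) ∧ (∀ s ∈ S, ∀ x ∈ W, (σ s x).1.1 = x) ∧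
      (∀ x ∈ W, Set.InjOn (fun s => σ s x) S) ∧
      (∀ x ∈ W, ∀ γ : RelGraph r, γ.1.1 = x → f.toFun γ ≠ 0 → ∃ s ∈ S, σ s x = γ) := by
  classical
  set ρ : RelGraph r → X := fun γ => γ.1.1 with hρ
  have hl : IsLocalHomeomorph ρ := hr.1
  set K := tsupport f.toFun with hK
  have hKc : IsCompact K := f.3
  have hfin : (K ∩ ρ ⁻¹' {x₀}).Finite := by
    refine (hKc.inter_right (isClosed_singleton.preimage hl.continuous)).finite ?_
    refine IsDiscrete.of_nhdsWithin fun γ hγ => ?_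
    obtain ⟨U, hU, hγU, hinj⟩ := hl.isLocallyInjective γ
    have : U ∩ (K ∩ ρ ⁻¹' {x₀}) ⊆ {γ} := fun δ hδ => hinj hδ.1 hγU (hδ.2.2.trans hγ.2.symm)
    rw [← Filter.principal_singleton, Filter.le_principal_iff]
    exact Filter.mem_of_superset
      (inter_mem (mem_nhdsWithin_of_mem_nhds (hU.mem_nhds hγU)) self_mem_nhdsWithin) this
  obtain ⟨U, hU, hUd⟩ := hfin.t2_separation
  set V : RelGraph r → Set (RelGraph r) := fun γ => U γ ∩ (hl.localInverseAt γ).target with hV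
  have hVo : ∀ γ, IsOpen (V γ) := fun γ => (hU γ).2.inter (hl.localInverseAt γ).open_target
  have hrest : IsClosed (ρ '' (K \ ⋃ γ ∈ hfin.toFinset, V γ)) :=
    ((hKc.diff (isOpen_biUnion fun γ _ => hVo γ)).image hl.continuous).isClosed
  have hx₀ : x₀ ∉ ρ '' (K \ ⋃ γ ∈ hfin.toFinset, V γ) := by
    rintro ⟨γ, ⟨hγK, hγV⟩, hγ⟩
    refine hγV (mem_biUnion (x := γ) ?_ ⟨(hU γ).1, hl.self_mem_localInverseAt_target⟩)
    simpa using ⟨hγK, hγ⟩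
  refine ⟨hfin.toFinset, fun γ => hl.localInverseAt γ,
    (ρ '' (K \ ⋃ γ ∈ hfin.toFinset, V γ))ᶜ ∩
      ⋂ γ ∈ hfin.toFinset, ((hl.localInverseAt γ).source ∩ hl.localInverseAt γ ⁻¹' U γ),
    ?_, ?_, ?_, ?_, ?_⟩
  · refine inter_mem (hrest.isOpen_compl.mem_nhds hx₀) ?_
    rw [Filter.biInter_finset_mem]
    intro γ hγ
    have hγ' : ρ γ = x₀ := by
      have := (hfin.mem_toFinset.1 hγ).2
      simpa using this
    have ho := (hl.localInverseAt γ).isOpen_inter_preimage (hU γ).2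
    refine ho.mem_nhds ⟨?_, ?_⟩
    · rw [← hγ']; exact hl.apply_self_mem_localInverseAt_source
    · rw [← hγ', mem_preimage, hl.localInverseAt_apply_self]; exact (hU γ).1
  · intro s hs
    refine (hl.localInverseAt s).continuousOn.mono fun x hx => ?_
    exact (mem_iInter₂.1 hx.2 s hs).1
  · intro s hs x hx
    exact hl.apply_localInverseAt_of_mem (mem_iInter₂.1 hx.2 s hs).1
  · intro x hx s hs t ht hst
    by_contra hne
    have h1 := (mem_iInter₂.1 hx.2 s hs).2
    have h2 := (mem_iInter₂.1 hx.2 t ht).2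
    simp only [mem_preimage] at h1 h2
    have hd := hUd (hfin.mem_toFinset.1 hs) (hfin.mem_toFinset.1 ht) hne
    refine Set.disjoint_left.1 hd h1 ?_
    change hl.localInverseAt s x = hl.localInverseAt t x at hst
    rw [hst]; exact h2
  · intro x hx γ hγ hne
    have hγK : γ ∈ K := subset_tsupport _ hne
    have : γ ∈ ⋃ γ ∈ hfin.toFinset, V γ := by
      by_contra h
      exact hx.1 ⟨γ, ⟨hγK, h⟩, hγ⟩
    obtain ⟨s, hs, hγs⟩ := mem_iUnion₂.1 this
    refine ⟨s, hs, ?_⟩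
    have := (hl.localInverseAt s).right_inv hγs.2
    rw [hl.localInverseAt_symm] at this
    rw [← hγ]
    exact this

lemma finite_coeff (f : ConvAlg r hr) (x : X) : {w | f.coeff x w ≠ 0}.Finite := by
  obtain ⟨S, σ, W, hW, -, -, -, h⟩ := f.exists_sections x
  refine (S.finite_toSet.image fun s => (σ s x).1.2).subset fun w hw => ?_
  have hxw := rel_of_coeff_ne hw
  have hw' : f.toFun ⟨(x, w), hxw⟩ ≠ 0 := by rwa [toFun_eq]
  obtain ⟨s, hs, he⟩ := h x (mem_of_mem_nhds hW) ⟨(x, w), hxw⟩ rfl hw'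
  exact ⟨s, hs, by simp [he]⟩

lemma continuous_conv (f g : ConvAlg r hr) :
    Continuous fun γ : RelGraph r => convFun f g γ.1.1 γ.1.2 := by
  classical
  rw [continuous_iff_continuousAt]
  intro γ₀
  obtain ⟨S, σ, W, hW, hc, hσ, hinj, hcov⟩ := f.exists_sections γ₀.1.1
  have hnhds : {γ : RelGraph r | γ.1.1 ∈ W} ∈ 𝓝 γ₀ :=
    (hr.1.continuous.tendsto γ₀) hW
  refine ContinuousOn.continuousAt ?_ hnhds
  have hrel : ∀ s ∈ S, ∀ γ : RelGraph r, γ.1.1 ∈ W → r (σ s γ.1.1).1.2 γ.1.2 := by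
    intro s hs γ hγ
    have h1 := (σ s γ.1.1).2
    rw [hσ s hs _ hγ] at h1
    exact r.trans (r.symm h1) γ.2
  have hsum : ∀ γ : RelGraph r, γ.1.1 ∈ W → convFun f g γ.1.1 γ.1.2 =
      ∑ s ∈ S, f.toFun (σ s γ.1.1) * g.coeff (σ s γ.1.1).1.2 γ.1.2 := by
    intro γ hγ
    have hinj' : Set.InjOn (fun s => (σ s γ.1.1).1.2) S := by
      intro s hs t ht hst
      refine hinj _ hγ hs ht (Subtype.ext (Prod.ext ?_ hst))
      exact (hσ s hs _ hγ).trans (hσ t ht _ hγ).symm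
    rw [convFun_eq_sum f g _ _ (S.image fun s => (σ s γ.1.1).1.2), Finset.sum_image hinj']
    · refine Finset.sum_congr rfl fun s hs => ?_
      rw [toFun_eq, hσ s hs _ hγ]
    · intro w hw
      have hxw := rel_of_coeff_ne hw
      have hw' : f.toFun ⟨(γ.1.1, w), hxw⟩ ≠ 0 := by rwa [toFun_eq]
      obtain ⟨s, hs, he⟩ := hcov _ hγ ⟨(γ.1.1, w), hxw⟩ rfl hw'
      exact Finset.mem_image.2 ⟨s, hs, by simp [he]⟩
  refine ContinuousOn.congr ?_ hsum
  refine continuousOn_finsetSum _ fun s hs => ?_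
  have hcs : Continuous fun γ : {γ : RelGraph r | γ.1.1 ∈ W} => σ s γ.1.1.1 := by
    have := continuousOn_iff_continuous_domRestrict.1 (hc s hs)
    exact this.comp (Continuous.subtype_mk (by fun_prop) fun γ => γ.2)
  rw [continuousOn_iff_continuous_domRestrict]
  have : Set.domRestrict {γ : RelGraph r | γ.1.1 ∈ W}
      (fun γ => f.toFun (σ s γ.1.1) * g.coeff (σ s γ.1.1).1.2 γ.1.2) =
      fun γ => f.toFun (σ s γ.1.1.1) *
        g.toFun ⟨((σ s γ.1.1.1).1.2, γ.1.1.2), hrel s hs γ.1 γ.2⟩ := by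
    funext γ
    simp only [Set.domRestrict_apply]
    rw [coeff_of_rel g (hrel s hs γ.1 γ.2)]
  rw [this]
  refine (f.2.comp hcs).mul (g.2.comp (Continuous.subtype_mk ?_ _))
  have h1 : Continuous fun γ : {γ : RelGraph r | γ.1.1 ∈ W} => (σ s γ.1.1.1).1 :=
    continuous_subtype_val.comp hcs
  fun_prop

lemma hasCompactSupport_conv (f g : ConvAlg r hr) :
    HasCompactSupport fun γ : RelGraph r => convFun f g γ.1.1 γ.1.2 := by
  set C : Set (RelGraph r × RelGraph r) :=
    {q | q.1.1.2 = q.2.1.1} ∩ (tsupport f.toFun ×ˢ tsupport g.toFun) with hC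
  have hCc : IsCompact C :=
    (f.3.isCompact.prod g.3.isCompact).inter_left
      (isClosed_eq (by fun_prop) (by fun_prop))
  set D : Set (X × X) := (fun q : RelGraph r × RelGraph r => (q.1.1.1, q.2.1.2)) '' C with hD
  have hDc : IsCompact D := hCc.image (by fun_prop)
  have hDr : D ⊆ Set.range (Subtype.val : RelGraph r → X × X) := by
    rintro _ ⟨q, hq, rfl⟩
    have h1 : r q.1.1.1 q.1.1.2 := q.1.2
    have h2 : r q.2.1.1 q.2.1.2 := q.2.2
    have h3 : q.1.1.2 = q.2.1.1 := hq.1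
    rw [h3] at h1
    exact ⟨⟨(q.1.1.1, q.2.1.2), Setoid.trans' r h1 h2⟩, rfl⟩
  have hKc : IsCompact ((Subtype.val : RelGraph r → X × X) ⁻¹' D) := by
    have he : (Subtype.val : RelGraph r → X × X) '' (Subtype.val ⁻¹' D) = D :=
      Set.image_preimage_eq_of_subset hDr
    exact IsInducing.subtypeVal.isCompact_iff.2 ((congrArg IsCompact he).mpr hDc)
  refine HasCompactSupport.intro hKc fun γ hγ => ?_
  unfold convFun
  refine finsum_eq_zero_of_forall_eq_zero fun w => ?_
  by_contra hne
  have hf := left_ne_zero_of_mul hne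
  have hg := right_ne_zero_of_mul hne
  have h1 := rel_of_coeff_ne hf
  have h2 := rel_of_coeff_ne hg
  refine hγ ⟨(⟨(γ.1.1, w), h1⟩, ⟨(w, γ.1.2), h2⟩), ⟨rfl, ?_, ?_⟩, rfl⟩
  · refine subset_tsupport _ ?_
    rwa [Function.mem_support, toFun_eq]
  · refine subset_tsupport _ ?_
    rwa [Function.mem_support, toFun_eq]

noncomputable instance : Mul (ConvAlg r hr) := ⟨fun f g =>
  ⟨fun γ => convFun f g γ.1.1 γ.1.2, continuous_conv f g, hasCompactSupport_conv f g⟩⟩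

lemma coeff_mul (f g : ConvAlg r hr) (x y : X) : (f * g).coeff x y = convFun f g x y := by
  by_cases h : r x y
  · rw [coeff_of_rel _ h]; rfl
  · rw [coeff_of_not_rel _ h]
    refine (finsum_eq_zero_of_forall_eq_zero fun w => ?_).symm
    by_contra hne
    exact h (r.trans (rel_of_coeff_ne (left_ne_zero_of_mul hne))
      (rel_of_coeff_ne (right_ne_zero_of_mul hne)))

lemma coeff_mul_eq_sum (f g : ConvAlg r hr) (x y : X) (A : Finset X)
    (hA : ∀ w, f.coeff x w ≠ 0 → w ∈ A) :
    (f * g).coeff x y = ∑ w ∈ A, f.coeff x w * g.coeff w y := by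
  rw [coeff_mul, convFun_eq_sum f g x y A hA]

lemma exists_finset (f : ConvAlg r hr) (x : X) : ∃ A : Finset X, ∀ w, f.coeff x w ≠ 0 → w ∈ A :=
  ⟨(f.finite_coeff x).toFinset, fun w hw => by simpa using hw⟩

lemma conv_assoc (f g h : ConvAlg r hr) : f * g * h = f * (g * h) := by
  classical
  refine ext_coeff fun x y => ?_
  obtain ⟨A, hA⟩ := f.exists_finset x
  choose B hB using fun w => g.exists_finset w
  have hBu : ∀ w ∈ A, ∀ v, g.coeff w v ≠ 0 → v ∈ A.biUnion B := fun w hw v hv =>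
    Finset.mem_biUnion.2 ⟨w, hw, hB w v hv⟩
  rw [coeff_mul_eq_sum (f * g) h x y (A.biUnion B), coeff_mul_eq_sum f (g * h) x y A hA]
  · simp_rw [coeff_mul_eq_sum f g x _ A hA, Finset.sum_mul]
    rw [Finset.sum_comm]
    refine Finset.sum_congr rfl fun w hw => ?_
    rw [coeff_mul_eq_sum g h w y _ (hBu w hw), Finset.mul_sum]
    exact Finset.sum_congr rfl fun v _ => mul_assoc _ _ _
  · intro v hv
    rw [coeff_mul_eq_sum f g x v A hA] at hv
    obtain ⟨w, hw, hne⟩ := Finset.exists_ne_zero_of_sum_ne_zero hv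
    exact hBu w hw v (right_ne_zero_of_mul hne)

noncomputable instance : NonUnitalRing (ConvAlg r hr) where
  mul_assoc := conv_assoc
  left_distrib f g h := ext_coeff fun x y => by
    obtain ⟨A, hA⟩ := f.exists_finset x
    simp [coeff_mul_eq_sum f _ x y A hA, mul_add, Finset.sum_add_distrib]
  right_distrib f g h := ext_coeff fun x y => by
    classical
    obtain ⟨A, hA⟩ := f.exists_finset x
    obtain ⟨B, hB⟩ := g.exists_finset x
    have hf : ∀ w, f.coeff x w ≠ 0 → w ∈ A ∪ B := fun w hw => Finset.mem_union_left _ (hA w hw)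
    have hg : ∀ w, g.coeff x w ≠ 0 → w ∈ A ∪ B := fun w hw => Finset.mem_union_right _ (hB w hw)
    rw [coeff_add, coeff_mul_eq_sum f h x y _ hf, coeff_mul_eq_sum g h x y _ hg,
      coeff_mul_eq_sum (f + g) h x y (A ∪ B), ← Finset.sum_add_distrib]
    · exact Finset.sum_congr rfl fun w _ => by rw [coeff_add, add_mul]
    · intro w hw
      by_contra hn
      have h1 : f.coeff x w = 0 := by by_contra h0; exact hn (hf w h0)
      have h2 : g.coeff x w = 0 := by by_contra h0; exact hn (hg w h0)
      exact hw (by simp [h1, h2])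
  zero_mul f := ext_coeff fun x y => by simp [coeff_mul, convFun]
  mul_zero f := ext_coeff fun x y => by simp [coeff_mul, convFun]

instance : IsScalarTower ℂ (ConvAlg r hr) (ConvAlg r hr) where
  smul_assoc c f g := ext_coeff fun x y => by
    obtain ⟨A, hA⟩ := f.exists_finset x
    have hA' : ∀ w, (c • f).coeff x w ≠ 0 → w ∈ A := fun w hw =>
      hA w (right_ne_zero_of_mul (by rwa [coeff_smul] at hw))
    simp only [smul_eq_mul, coeff_smul, coeff_mul_eq_sum f g x y A hA,
      coeff_mul_eq_sum (c • f) g x y A hA', Finset.mul_sum, mul_assoc]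

instance : SMulCommClass ℂ (ConvAlg r hr) (ConvAlg r hr) where
  smul_comm c f g := ext_coeff fun x y => by
    obtain ⟨A, hA⟩ := f.exists_finset x
    simp only [smul_eq_mul, coeff_smul, coeff_mul_eq_sum f g x y A hA,
      coeff_mul_eq_sum f (c • g) x y A hA, Finset.mul_sum]
    exact Finset.sum_congr rfl fun w _ => by ring

noncomputable instance : StarRing (ConvAlg r hr) where
  star_involutive f := ext_coeff fun x y => by simp
  star_add f g := ext_coeff fun x y => by simp
  star_mul f g := ext_coeff fun x y => by
    classical
    obtain ⟨A, hA⟩ := f.exists_finset y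
    obtain ⟨B, hB⟩ := (star g).exists_finset x
    have hf : ∀ w, f.coeff y w ≠ 0 → w ∈ A ∪ B := fun w hw => Finset.mem_union_left _ (hA w hw)
    have hg : ∀ w, (star g).coeff x w ≠ 0 → w ∈ A ∪ B :=
      fun w hw => Finset.mem_union_right _ (hB w hw)
    rw [coeff_star, coeff_mul_eq_sum f g y x _ hf, coeff_mul_eq_sum (star g) (star f) x y _ hg,
      star_sum]
    exact Finset.sum_congr rfl fun w _ => by simp [mul_comm]

instance : StarModule ℂ (ConvAlg r hr) where
  star_smul c f := ext_coeff fun x y => by simp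

/-- The `I`-norm of `f ∈ C_c(R)`: the larger one of the suprema over `x` of
`∑_{y ∼ x} |f(x, y)|` and of `∑_{y ∼ x} |f(y, x)|`. -/
noncomputable def INorm (f : ConvAlg r hr) : ℝ :=
  max (⨆ x, ∑ᶠ y, ‖f.coeff x y‖) (⨆ x, ∑ᶠ y, ‖f.coeff y x‖)

lemma sum_norm_coeff_locally_bounded (f : ConvAlg r hr) (x₀ : X) :
    ∃ W ∈ 𝓝 x₀, ∃ M : ℝ, ∀ x ∈ W, ∑ᶠ y, ‖f.coeff x y‖ ≤ M := by
  classical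
  obtain ⟨C, hC⟩ := f.3.exists_bound_of_continuous f.2
  obtain ⟨S, σ, W, hW, -, -, -, h⟩ := f.exists_sections x₀
  refine ⟨W, hW, S.card * C, fun x hx => ?_⟩
  have hcov : ∀ w, f.coeff x w ≠ 0 → w ∈ S.image fun s => (σ s x).1.2 := fun w hw => by
    have hxw := rel_of_coeff_ne hw
    have hw' : f.toFun ⟨(x, w), hxw⟩ ≠ 0 := by rwa [toFun_eq]
    obtain ⟨s, hs, he⟩ := h x hx ⟨(x, w), hxw⟩ rfl hw'
    exact Finset.mem_image.2 ⟨s, hs, by simp [he]⟩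
  have hC0 : ∀ w, ‖f.coeff x w‖ ≤ C := fun w => by
    by_cases hxw : r x w
    · rw [coeff_of_rel _ hxw]; exact hC _
    · rw [coeff_of_not_rel _ hxw, norm_zero]
      exact (norm_nonneg _).trans (hC ⟨(x, x), r.refl x⟩)
  have hCnn : 0 ≤ C := (norm_nonneg _).trans (hC0 x)
  rw [finsum_eq_sum_of_support_subset (s := S.image fun s => (σ s x).1.2) _
    (fun w hw => hcov w (norm_ne_zero_iff.1 hw))]
  calc _ ≤ ∑ _w ∈ S.image fun s => (σ s x).1.2, C := Finset.sum_le_sum fun w _ => hC0 w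
    _ = (S.image fun s => (σ s x).1.2).card * C := by simp
    _ ≤ S.card * C := by gcongr; exact Finset.card_image_le

/-- The sums in the definition of the `I`-norm are bounded, so that the suprema are true ones. -/
lemma bddAbove_sum_norm_coeff (f : ConvAlg r hr) :
    BddAbove (Set.range fun x => ∑ᶠ y, ‖f.coeff x y‖) ∧
      BddAbove (Set.range fun x => ∑ᶠ y, ‖f.coeff y x‖) := by
  have key : ∀ f : ConvAlg r hr, BddAbove (Set.range fun x => ∑ᶠ y, ‖f.coeff x y‖) := by
    intro f
    have hK : IsCompact ((fun γ : RelGraph r => γ.1.1) '' tsupport f.toFun) :=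
      f.3.isCompact.image hr.1.continuous
    obtain ⟨M, hM⟩ : ∃ M : ℝ, ∀ x ∈ (fun γ : RelGraph r => γ.1.1) '' tsupport f.toFun,
        ∑ᶠ y, ‖f.coeff x y‖ ≤ M := by
      refine hK.induction_on (p := fun s => ∃ M : ℝ, ∀ x ∈ s, ∑ᶠ y, ‖f.coeff x y‖ ≤ M)
        ⟨0, by simp⟩ (fun s t hst ⟨M, hM⟩ => ⟨M, fun x hx => hM x (hst hx)⟩) ?_ ?_
      · rintro s t ⟨M, hM⟩ ⟨N, hN⟩
        refine ⟨max M N, ?_⟩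
        rintro x (hx | hx)
        · exact (hM x hx).trans (le_max_left _ _)
        · exact (hN x hx).trans (le_max_right _ _)
      · intro x _
        obtain ⟨W, hW, h⟩ := f.sum_norm_coeff_locally_bounded x
        exact ⟨W, mem_nhdsWithin_of_mem_nhds hW, h⟩
    refine ⟨max M 0, ?_⟩
    rintro _ ⟨x, rfl⟩
    by_cases hx : x ∈ (fun γ : RelGraph r => γ.1.1) '' tsupport f.toFun
    · exact (hM x hx).trans (le_max_left _ _)
    · refine (finsum_eq_zero_of_forall_eq_zero fun y => ?_).le.trans (le_max_right _ _)
      rw [norm_eq_zero]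
      by_contra hne
      have hxy := rel_of_coeff_ne hne
      refine hx ⟨⟨(x, y), hxy⟩, subset_tsupport _ ?_, rfl⟩
      rwa [Function.mem_support, toFun_eq]
  refine ⟨key f, ?_⟩
  simpa using key (star f)

/-- The C*-seminorms on the involutive algebra `C_c(R)` that are bounded by the `I`-norm; these are
the seminorms `f ↦ ‖π f‖` for the `I`-norm bounded `*`-representations `π` of `C_c(R)` on Hilbert
spaces. -/
structure IsCStarSeminorm (p : Seminorm ℂ (ConvAlg r hr)) : Prop where
  mul_le : ∀ f g, p (f * g) ≤ p f * p g
  star_mul_self : ∀ f, p (star f * f) = p f ^ 2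
  le_INorm : ∀ f, p f ≤ INorm f

/-- The norm of the full C*-algebra: the supremum of all the `I`-norm bounded C*-seminorms. -/
noncomputable def fullNorm (f : ConvAlg r hr) : ℝ :=
  ⨆ p : {p : Seminorm ℂ (ConvAlg r hr) // IsCStarSeminorm p}, p.1 f

lemma bddAbove_seminorms (f : ConvAlg r hr) : BddAbove (Set.range
    fun p : {p : Seminorm ℂ (ConvAlg r hr) // IsCStarSeminorm p} => p.1 f) :=
  ⟨INorm f, by rintro _ ⟨p, rfl⟩; exact p.2.le_INorm f⟩

lemma le_fullNorm (f : ConvAlg r hr)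
    (p : {p : Seminorm ℂ (ConvAlg r hr) // IsCStarSeminorm p}) : p.1 f ≤ fullNorm f :=
  le_ciSup (bddAbove_seminorms f) p

lemma fullNorm_nonneg (f : ConvAlg r hr) : 0 ≤ fullNorm f :=
  Real.iSup_nonneg fun p => apply_nonneg p.1 f

lemma IsCStarSeminorm.le_star {p : Seminorm ℂ (ConvAlg r hr)} (hp : IsCStarSeminorm p)
    (f : ConvAlg r hr) : p f ≤ p (star f) := by
  have h1 := hp.star_mul_self f
  have h2 := hp.mul_le (star f) f
  have h3 := apply_nonneg p f
  have h4 := apply_nonneg p (star f)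
  by_contra h
  nlinarith

lemma fullNorm_star (f : ConvAlg r hr) : fullNorm (star f) = fullNorm f := by
  unfold fullNorm
  congr 1
  funext p
  exact le_antisymm (by simpa using p.2.le_star (star f)) (p.2.le_star f)

lemma fullNorm_star_mul_self (f : ConvAlg r hr) :
    fullNorm f * fullNorm f ≤ fullNorm (star f * f) := by
  have h : fullNorm f ≤ √(fullNorm (star f * f)) := by
    refine Real.iSup_le (fun p => Real.le_sqrt_of_sq_le ?_) (Real.sqrt_nonneg _)
    rw [← p.2.star_mul_self]
    exact le_fullNorm _ p
  calc fullNorm f * fullNorm f ≤ √(fullNorm (star f * f)) * √(fullNorm (star f * f)) :=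
        mul_self_le_mul_self (fullNorm_nonneg f) h
    _ = _ := Real.mul_self_sqrt (fullNorm_nonneg _)

/-- The additive seminormed group underlying `C_c(R)` with its full norm. -/
noncomputable abbrev seminormedAddCommGroup : SeminormedAddCommGroup (ConvAlg r hr) :=
  AddGroupSeminorm.toSeminormedAddCommGroup
    { toFun := fullNorm
      map_zero' := by simp [fullNorm]
      add_le' := fun f g => Real.iSup_le
        (fun p => (map_add_le_add p.1 f g).trans
          (add_le_add (le_fullNorm f p) (le_fullNorm g p)))
        (add_nonneg (fullNorm_nonneg f) (fullNorm_nonneg g))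
      neg' := fun f => by simp [fullNorm] }

lemma fullNorm_mul_le (f g : ConvAlg r hr) : fullNorm (f * g) ≤ fullNorm f * fullNorm g :=
  Real.iSup_le
    (fun p => (p.2.mul_le f g).trans (mul_le_mul (le_fullNorm f p) (le_fullNorm g p)
      (apply_nonneg _ _) (fullNorm_nonneg f)))
    (mul_nonneg (fullNorm_nonneg f) (fullNorm_nonneg g))

noncomputable instance : NonUnitalSeminormedRing (ConvAlg r hr) :=
  { (inferInstance : NonUnitalRing (ConvAlg r hr)),
    (seminormedAddCommGroup : SeminormedAddCommGroup (ConvAlg r hr)) with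
    norm_mul_le := fullNorm_mul_le }

lemma norm_def (f : ConvAlg r hr) : ‖f‖ = fullNorm f := rfl

noncomputable instance : NormedSpace ℂ (ConvAlg r hr) where
  norm_smul_le c f := Real.iSup_le
    (fun p => by
      rw [map_smul_eq_mul]
      exact mul_le_mul_of_nonneg_left (le_fullNorm f p) (norm_nonneg c))
    (mul_nonneg (norm_nonneg c) (fullNorm_nonneg f))

instance : NormedStarGroup (ConvAlg r hr) where
  norm_star_le f := (fullNorm_star f).le

end ConvAlg

open UniformSpace in
/-- The C*-algebra `C*(R)` of an étale equivalence relation `R` on a Hausdorff space: the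
(Hausdorff) completion of the convolution algebra `C_c(R)` in its full norm. -/
abbrev GroupoidCStar [T2Space X] (r : Setoid X) (hr : IsEtaleRel r) : Type u :=
  Completion (ConvAlg r hr)

namespace GroupoidCStar

open UniformSpace Completion

variable [T2Space X] {r : Setoid X} {hr : IsEtaleRel r}

/-- The canonical map `C_c(R) → C*(R)`. -/
noncomputable def ofConv (f : ConvAlg r hr) : GroupoidCStar r hr := (f : Completion (ConvAlg r hr))

lemma isDenseInducing_ofConv : IsDenseInducing (ofConv : ConvAlg r hr → GroupoidCStar r hr) :=
  Completion.isDenseInducing_coe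

lemma continuous_ofConv : Continuous (ofConv : ConvAlg r hr → GroupoidCStar r hr) :=
  Completion.continuous_coe _

lemma ofConv_add (f g : ConvAlg r hr) : ofConv (f + g) = ofConv f + ofConv g :=
  Completion.coe_add f g

lemma ofConv_smul (c : ℂ) (f : ConvAlg r hr) : ofConv (c • f) = c • ofConv f :=
  Completion.coe_smul c f

lemma norm_ofConv (f : ConvAlg r hr) : ‖ofConv f‖ = ‖f‖ := Completion.norm_coe f

lemma ofConv_zero : ofConv (0 : ConvAlg r hr) = 0 := rfl

@[elab_as_elim]
lemma induction₁ {P : GroupoidCStar r hr → Prop} (a : GroupoidCStar r hr)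
    (hP : IsClosed {a | P a}) (h : ∀ f : ConvAlg r hr, P (ofConv f)) : P a :=
  Completion.induction_on a hP h

@[elab_as_elim]
lemma induction₂ {P : GroupoidCStar r hr → GroupoidCStar r hr → Prop} (a b : GroupoidCStar r hr)
    (hP : IsClosed {q : GroupoidCStar r hr × GroupoidCStar r hr | P q.1 q.2})
    (h : ∀ f g : ConvAlg r hr, P (ofConv f) (ofConv g)) : P a b :=
  Completion.induction_on₂ a b hP h

@[elab_as_elim]
lemma induction₃ {P : GroupoidCStar r hr → GroupoidCStar r hr → GroupoidCStar r hr → Prop}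
    (a b c : GroupoidCStar r hr)
    (hP : IsClosed {q : GroupoidCStar r hr × GroupoidCStar r hr × GroupoidCStar r hr |
      P q.1 q.2.1 q.2.2})
    (h : ∀ f g k : ConvAlg r hr, P (ofConv f) (ofConv g) (ofConv k)) : P a b c :=
  Completion.induction_on₃ a b c hP h

/-- The product of `C*(R)` extends the convolution by continuity. -/
noncomputable instance : Mul (GroupoidCStar r hr) :=
  ⟨Function.curry <| (isDenseInducing_ofConv.prodMap isDenseInducing_ofConv).extend
    fun q : ConvAlg r hr × ConvAlg r hr => ofConv (q.1 * q.2)⟩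

/-- The involution of `C*(R)` extends that of `C_c(R)` by continuity. -/
noncomputable instance : Star (GroupoidCStar r hr) :=
  ⟨Completion.map (star : ConvAlg r hr → ConvAlg r hr)⟩

lemma ofConv_mul (f g : ConvAlg r hr) : ofConv (f * g) = ofConv f * ofConv g :=
  ((isDenseInducing_ofConv.prodMap isDenseInducing_ofConv).extend_eq
    (continuous_ofConv.comp continuous_mul) (f, g)).symm

lemma ofConv_star (f : ConvAlg r hr) : ofConv (star f) = star (ofConv f) :=
  (Completion.map_coe star_isometry.uniformContinuous f).symm

instance : ContinuousMul (GroupoidCStar r hr) where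
  continuous_mul := by
    let m := (AddMonoidHom.mul : ConvAlg r hr →+ ConvAlg r hr →+ ConvAlg r hr).compr₂
      (toCompl (α := ConvAlg r hr))
    have : Continuous fun p : ConvAlg r hr × ConvAlg r hr => m p.1 p.2 :=
      (Completion.continuous_coe (ConvAlg r hr)).comp continuous_mul
    have di : IsDenseInducing (toCompl : ConvAlg r hr → Completion (ConvAlg r hr)) :=
      Completion.isDenseInducing_coe
    exact (di.extend_Z_bilin di this :)

instance : ContinuousStar (GroupoidCStar r hr) where
  continuous_star := by
    change Continuous (Completion.map (star : ConvAlg r hr → ConvAlg r hr))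
    exact Completion.continuous_map

noncomputable instance : NonUnitalRing (GroupoidCStar r hr) :=
  { (inferInstance : AddCommGroup (GroupoidCStar r hr)),
    (inferInstance : Mul (GroupoidCStar r hr)) with
    zero_mul := fun a => by
      induction a using induction₁ with
      | hP => exact isClosed_eq (by fun_prop) (by fun_prop)
      | h f =>
        rw [← ofConv_zero, ← ofConv_mul, zero_mul]
    mul_zero := fun a => by
      induction a using induction₁ with
      | hP => exact isClosed_eq (by fun_prop) (by fun_prop)
      | h f =>
        rw [← ofConv_zero, ← ofConv_mul, mul_zero]
    mul_assoc := fun a b c => by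
      induction a, b, c using induction₃ with
      | hP => exact isClosed_eq (by fun_prop) (by fun_prop)
      | h f g k =>
        simp only [← ofConv_mul, mul_assoc]
    left_distrib := fun a b c => by
      induction a, b, c using induction₃ with
      | hP => exact isClosed_eq (by fun_prop) (by fun_prop)
      | h f g k =>
        simp only [← ofConv_mul, ← ofConv_add, mul_add]
    right_distrib := fun a b c => by
      induction a, b, c using induction₃ with
      | hP => exact isClosed_eq (by fun_prop) (by fun_prop)
      | h f g k =>
        simp only [← ofConv_mul, ← ofConv_add, add_mul] }

noncomputable instance : NonUnitalNormedRing (GroupoidCStar r hr) :=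
  { (inferInstance : NormedAddCommGroup (GroupoidCStar r hr)),
    (inferInstance : NonUnitalRing (GroupoidCStar r hr)) with
    norm_mul_le := fun a b => by
      induction a, b using induction₂ with
      | hP => exact isClosed_le (by fun_prop) (by fun_prop)
      | h f g =>
        rw [← ofConv_mul, norm_ofConv, norm_ofConv, norm_ofConv]
        exact norm_mul_le f g }

noncomputable instance : StarRing (GroupoidCStar r hr) where
  star_involutive a := by
    induction a using induction₁ with
    | hP => exact isClosed_eq (by fun_prop) (by fun_prop)
    | h f =>
      rw [← ofConv_star, ← ofConv_star, star_star]
  star_add a b := by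
    induction a, b using induction₂ with
    | hP => exact isClosed_eq (by fun_prop) (by fun_prop)
    | h f g =>
      simp only [← ofConv_star, ← ofConv_add, star_add]
  star_mul a b := by
    induction a, b using induction₂ with
    | hP => exact isClosed_eq (by fun_prop) (by fun_prop)
    | h f g =>
      simp only [← ofConv_star, ← ofConv_mul, star_mul]

instance : CStarRing (GroupoidCStar r hr) where
  norm_mul_self_le a := by
    induction a using induction₁ with
    | hP => exact isClosed_le (by fun_prop) (by fun_prop)
    | h f =>
      rw [← ofConv_star, ← ofConv_mul, norm_ofConv, norm_ofConv]
      exact ConvAlg.fullNorm_star_mul_self f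

instance : IsScalarTower ℂ (GroupoidCStar r hr) (GroupoidCStar r hr) where
  smul_assoc c a b := by
    induction a, b using induction₂ with
    | hP =>
      exact isClosed_eq ((continuous_fst.const_smul c).mul continuous_snd)
        ((continuous_fst.mul continuous_snd).const_smul c)
    | h f g => simp only [smul_eq_mul, ← ofConv_mul, ← ofConv_smul, smul_mul_assoc]

instance : SMulCommClass ℂ (GroupoidCStar r hr) (GroupoidCStar r hr) where
  smul_comm c a b := by
    induction a, b using induction₂ with
    | hP =>
      exact isClosed_eq ((continuous_fst.mul continuous_snd).const_smul c)
        (continuous_fst.mul (continuous_snd.const_smul c))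
    | h f g => simp only [smul_eq_mul, ← ofConv_mul, ← ofConv_smul, mul_smul_comm]

instance : StarModule ℂ (GroupoidCStar r hr) where
  star_smul c a := by
    induction a using induction₁ with
    | hP =>
      exact isClosed_eq (continuous_star.comp (continuous_id.const_smul c))
        (continuous_star.const_smul (star c))
    | h f => simp only [← ofConv_star, ← ofConv_smul, star_smul]

/-- `C*(R)` is a C*-algebra. -/
noncomputable instance : NonUnitalCStarAlgebra (GroupoidCStar r hr) where
  toCompleteSpace := inferInstance
  norm_mul_self_le := CStarRing.norm_mul_self_le
  norm_smul_le := norm_smul_le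
  smul_assoc := smul_assoc
  smul_comm := smul_comm
  star_smul := star_smul

end GroupoidCStar

end EtaleRelation

/-! ### Irreducible representations, spectrum, CCR algebras -/

section Spectrum

/-- An irreducible representation of the C*-algebra `A` on a Hilbert space: a nonzero
`*`-homomorphism into the bounded operators without nontrivial closed invariant subspaces.  (The
Hilbert space of an irreducible representation of `A` is a completion of a quotient of `A`, so that
no generality is lost by taking it in the universe of `A`.) -/
structure IrreducibleRep (A : Type u) [NonUnitalCStarAlgebra A] : Type (u + 1) where
  H : Type u
  [normedAddCommGroup : NormedAddCommGroup H]
  [innerProductSpace : InnerProductSpace ℂ H]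
  [completeSpace : CompleteSpace H]
  π : A →⋆ₙₐ[ℂ] (H →L[ℂ] H)
  exists_ne_zero : ∃ a, π a ≠ 0
  irreducible : ∀ K : Submodule ℂ H, IsClosed (K : Set H) → (∀ a, ∀ v ∈ K, π a v ∈ K) →
    K = ⊥ ∨ K = ⊤

attribute [instance] IrreducibleRep.normedAddCommGroup IrreducibleRep.innerProductSpace
  IrreducibleRep.completeSpace

variable (A : Type u) [NonUnitalCStarAlgebra A]

/-- Unitary equivalence of irreducible representations. -/
instance IrreducibleRep.setoid : Setoid (IrreducibleRep A) where
  r ρ σ := ∃ U : ρ.H ≃ₗᵢ[ℂ] σ.H, ∀ a v, U (ρ.π a v) = σ.π a (U v)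
  iseqv :=
    { refl := fun ρ => ⟨LinearIsometryEquiv.refl ℂ ρ.H, fun _ _ => rfl⟩
      symm := fun ⟨U, hU⟩ => ⟨U.symm, fun a v => by
        rw [LinearIsometryEquiv.symm_apply_eq, hU, U.apply_symm_apply]⟩
      trans := fun ⟨U, hU⟩ ⟨V, hV⟩ => ⟨U.trans V, fun a v => by
        simp [hU, hV]⟩ }

/-- The spectrum of a C*-algebra: the unitary equivalence classes of its irreducible
representations. -/
def CStarSpectrum : Type (u + 1) := Quotient (IrreducibleRep.setoid A)

/-- The open sets of the spectrum are the sets of all classes of irreducible representations that do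
not vanish on a given two-sided ideal (the inverse images of the hull-kernel open sets of the
primitive ideal space). -/
instance : TopologicalSpace (CStarSpectrum A) :=
  TopologicalSpace.generateFrom
    {U | ∃ J : TwoSidedIdeal A, U = {y | ∃ ρ : IrreducibleRep A,
      Quotient.mk (IrreducibleRep.setoid A) ρ = y ∧ ∃ a ∈ J, ρ.π a ≠ 0}}

/-- A C*-algebra is CCR (liminal) if all its irreducible representations are by compact
operators. -/
def IsCCR : Prop := ∀ (ρ : IrreducibleRep A) (a : A), IsCompactOperator (ρ.π a)

end Spectrum

/-! ### Locally compact spaces that need not be Hausdorff -/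

section Topology

/-- Every point has a compact Hausdorff neighbourhood. -/
def LocallyCompactHausdorff (Y : Type*) [TopologicalSpace Y] : Prop :=
  ∀ y : Y, ∃ K ∈ 𝓝 y, IsCompact K ∧ T2Space K

/-- The Hausdorff points of a space: those that are separated by disjoint open neighbourhoods from
any other point. -/
def hausdorffPoints (Y : Type*) [TopologicalSpace Y] : Set Y :=
  {y | ∀ y', y' ≠ y → ∃ U V : Set Y, IsOpen U ∧ IsOpen V ∧ y ∈ U ∧ y' ∈ V ∧ Disjoint U V}

end Topology

/-! ### The example -/

section Example

variable {Z : Type u}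

/-- `R = {(a, (i, j)) : i = j if a ∈ {z_i, z_j}}`, as a subset of `Z × (ℕ × ℕ)`. -/
def exampleRel (z : ℕ → Z) : Set (Z × (ℕ × ℕ)) :=
  {p | p.1 ∈ ({z p.2.1, z p.2.2} : Set Z) → p.2.1 = p.2.2}

/-- `R` as an equivalence relation on `Z × ℕ`, where `(a, (i, j))` stands for the pair
`((a, i), (a, j))`. -/
def exampleSetoid (z : ℕ → Z) : Setoid (Z × ℕ) where
  r x y := x.1 = y.1 ∧ (x.1, (x.2, y.2)) ∈ exampleRel z
  iseqv :=
    { refl := fun x => ⟨rfl, fun _ => rfl⟩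
      symm := by
        rintro ⟨a, i⟩ ⟨b, j⟩ ⟨rfl : a = b, h⟩
        exact ⟨rfl, fun h' => (h (Set.pair_comm (z i) (z j) ▸ h')).symm⟩
      trans := by
        rintro ⟨a, i⟩ ⟨b, j⟩ ⟨c, k⟩ ⟨rfl : a = b, h⟩ ⟨rfl : a = c, h'⟩
        refine ⟨rfl, ?_⟩
        simp only [exampleRel, Set.mem_ofPred_eq, Set.mem_insert_iff, Set.mem_singleton_iff] at h h' ⊢
        rintro (ha | ha)
        · have := h (Or.inl ha); subst this; exact h' (Or.inl ha)
        · have := h' (Or.inr ha); subst this; exact h (Or.inr ha) }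

/-- The set `Y = Z ⊔ ℕ`; it gets its own topology, which is not that of a disjoint sum. -/
def ExampleSpace (_z : ℕ → Z) : Type u := Z ⊕ ℕ

open Classical in
/-- The map `Z × ℕ → Y` that sends `(a, i)` to `a` if `a ≠ z_i` and to `i` if `a = z_i`. -/
noncomputable def exampleMap (z : ℕ → Z) (x : Z × ℕ) : ExampleSpace z :=
  if x.1 = z x.2 then (Sum.inr x.2 : Z ⊕ ℕ) else (Sum.inl x.1 : Z ⊕ ℕ)

/-- `Y = Z ⊔ ℕ` carries the quotient topology of `Z × ℕ`. -/
noncomputable instance [TopologicalSpace Z] (z : ℕ → Z) : TopologicalSpace (ExampleSpace z) :=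
  TopologicalSpace.coinduced (exampleMap z) instTopologicalSpaceProd

/-- The subset of `Y` that results from `U ⊆ Z` by replacing the point `z_i` by `i` for all `i` in
the finite set `F`. -/
def replacePoints (z : ℕ → Z) (U : Set Z) (F : Finset ℕ) : Set (ExampleSpace z) :=
  (Sum.inl '' (U \ z '' F) ∪ Sum.inr '' F : Set (Z ⊕ ℕ))

end Example

/-!
The statements on the topology of `Y` come down to the description of its open sets by slices: `V` is
open in `Y` if and only if the set of all `a` with `exampleMap z (a, i) ∈ V` is open in `Z` for every
`i`. Each sheet `Z × {i}` embeds as an open subset of `Y`, in which `i` takes the place of `z i`; the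
points `z i` and `i` cannot be separated because `z i` is not isolated. The graph of `R` is an open
subset of `Z × (ℕ × ℕ)`, which makes range and source local homeomorphisms.

The statements on `C*(R)` hold for every étale equivalence relation `R` on a locally compact Hausdorff
space `X` whose graph carries the topology of `X × X` and whose classes are closed: `C*(R)` is CCR, its
spectrum is the quotient space `X/R`, and it is separable if `X` is second countable. For the étale
property in the topology of `X × X` makes the diagonal open in the graph, so that every point of `X`
has a neighbourhood without distinct equivalent points (`IsEtaleRel.exists_isOpen_transversal`).

* For `x : X` the regular representation `λ_x` lets `f ∈ C_c(R)` act on `ℓ²` of the class of `x` as the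
  matrix `f(y, w)`. Schur's test bounds it by the `I`-norm (`ConvAlg.sum_norm_regFun_sq_le`), hence it
  extends to `C*(R)`; it is irreducible because `C_c(R)` contains elements that restrict to the matrix
  units of the class (`ConvAlg.exists_matrixUnit`, `GroupoidCStar.regRep`).
* Every irreducible representation `ρ` is a regular one (`GroupoidCStar.exists_equiv_regRep`). A
  partition of unity yields a point `x` near which `ρ` does not kill the functions on the diagonal. Let
  `U` be a neighbourhood of `x` without distinct equivalent points. For functions `h`, `k` supported in
  `U`, the product `h f k` is the diagonal element `y ↦ h(y) f(y, y) k(y)`, hence `hk = 0` forces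
  `ρ(h) = 0` or `ρ(k) = 0`, and `ρ(h)` depends on `h(x)` only. If `e` is a real function supported in
  `U` with `e(x) = 1`, then `P = ρ(e)` is a nonzero projection with `P ρ(f) P = f(x, x) P`. A unit vector
  in its range has the matrix coefficient `f ↦ f(x, x)`, as has the basis vector of `x` for `λ_x`; by
  the uniqueness part of the GNS construction `ρ` is equivalent to `λ_x`.
* Equivalent points have equivalent regular representations for the same reason, and closed classes
  are told apart by functions on the diagonal. The map from `X/R` to the spectrum is continuous because
  matrix units move nonzero matrix coefficients of elements of an ideal to the diagonal, where they are
  continuous functions on `X`; it is open because an open invariant set belongs to the ideal of the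
  elements killed by the regular representations outside of it.
* On a closed class, elements of `C_c(R)` act by operators of finite rank, hence `C*(R)` acts by compact
  operators.
* `C_c(R)` is the union of countably many continuous images `e_n · C(R)` of the space of all continuous
  functions on the graph with the compact-open topology, which is separable if `X` is second countable.
-/

/-! ### The space `Y` -/

section ExampleTopology

variable {Z : Type u} {z : ℕ → Z}

lemma exampleMap_of_eq {a : Z} {i : ℕ} (h : a = z i) :
    exampleMap z (a, i) = (Sum.inr i : Z ⊕ ℕ) := if_pos h

lemma exampleMap_of_ne {a : Z} {i : ℕ} (h : a ≠ z i) :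
    exampleMap z (a, i) = (Sum.inl a : Z ⊕ ℕ) := if_neg h

lemma exampleMap_eq_inl_iff {a b : Z} {i : ℕ} :
    exampleMap z (a, i) = (Sum.inl b : Z ⊕ ℕ) ↔ a ≠ z i ∧ a = b := by
  by_cases h : a = z i
  · rw [exampleMap_of_eq h]; simp [h]
  · rw [exampleMap_of_ne h]
    change (Sum.inl a : Z ⊕ ℕ) = Sum.inl b ↔ _
    simp [h]

lemma exampleMap_eq_inr_iff {a : Z} {i j : ℕ} :
    exampleMap z (a, i) = (Sum.inr j : Z ⊕ ℕ) ↔ a = z i ∧ i = j := by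
  by_cases h : a = z i
  · rw [exampleMap_of_eq h]
    change (Sum.inr i : Z ⊕ ℕ) = Sum.inr j ↔ _
    simp [h]
  · rw [exampleMap_of_ne h]; simp [h]

lemma exampleMap_eq_iff (x y : Z × ℕ) :
    exampleMap z x = exampleMap z y ↔ exampleSetoid z x y := by
  obtain ⟨a, i⟩ := x
  obtain ⟨b, j⟩ := y
  change _ ↔ a = b ∧ (a ∈ ({z i, z j} : Set Z) → i = j)
  rw [Set.mem_insert_iff, Set.mem_singleton_iff]
  by_cases h : b = z j
  · rw [exampleMap_of_eq h, exampleMap_eq_inr_iff]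
    constructor
    · rintro ⟨rfl, rfl⟩; exact ⟨h.symm, fun _ => rfl⟩
    · rintro ⟨rfl, h'⟩
      obtain rfl := h' (Or.inr h)
      exact ⟨h, rfl⟩
  · rw [exampleMap_of_ne h, exampleMap_eq_inl_iff]
    constructor
    · rintro ⟨h1, rfl⟩; exact ⟨rfl, fun h' => (h'.elim h1 h).elim⟩
    · rintro ⟨rfl, h'⟩
      refine ⟨fun h1 => h ?_, rfl⟩
      rw [← h' (Or.inl h1)]; exact h1

lemma inl_mem_replacePoints {U : Set Z} {F : Finset ℕ} {a : Z} :
    (Sum.inl a : Z ⊕ ℕ) ∈ (replacePoints z U F : Set (Z ⊕ ℕ)) ↔ a ∈ U ∧ ∀ i ∈ F, z i ≠ a := by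
  change (Sum.inl a : Z ⊕ ℕ) ∈ (Sum.inl '' (U \ z '' F) ∪ Sum.inr '' F : Set (Z ⊕ ℕ)) ↔ _
  simp

lemma inr_mem_replacePoints {U : Set Z} {F : Finset ℕ} {i : ℕ} :
    (Sum.inr i : Z ⊕ ℕ) ∈ (replacePoints z U F : Set (Z ⊕ ℕ)) ↔ i ∈ F := by
  change (Sum.inr i : Z ⊕ ℕ) ∈ (Sum.inl '' (U \ z '' F) ∪ Sum.inr '' F : Set (Z ⊕ ℕ)) ↔ _
  simp

variable [TopologicalSpace Z]

lemma isOpen_exampleSpace_iff {V : Set (ExampleSpace z)} :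
    IsOpen V ↔ ∀ i, IsOpen {a | exampleMap z (a, i) ∈ V} := by
  refine isOpen_coinduced.trans ⟨fun h i => h.preimage (by fun_prop : Continuous fun a : Z => (a, i)),
    fun h => isOpen_iff_mem_nhds.2 ?_⟩
  rintro ⟨a, i⟩ hx
  rw [nhds_prod_eq, nhds_discrete ℕ, prod_pure]
  exact Filter.mem_map.2 ((h i).mem_nhds hx)

lemma exists_ne_of_denseRange [T2Space Z] (hdense : DenseRange z)
    (hiso : ∀ n, ¬ IsOpen ({z n} : Set Z)) (a : Z) : ∃ i, a ≠ z i := by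
  by_contra! h
  have hr : Set.range z = {a} := by
    ext b; constructor
    · rintro ⟨i, rfl⟩; exact (h i).symm
    · rintro rfl; exact ⟨0, (h 0).symm⟩
  have h1 : ({a} : Set Z) = Set.univ := by
    rw [← hdense.closure_eq, hr, closure_singleton]
  exact hiso 0 (by rw [← h 0, h1]; exact isOpen_univ)

lemma isQuotientMap_exampleMap [T2Space Z] (hdense : DenseRange z)
    (hiso : ∀ n, ¬ IsOpen ({z n} : Set Z)) : IsQuotientMap (exampleMap z) := by
  refine ⟨⟨rfl⟩, ?_⟩
  rintro (a | i)
  · obtain ⟨i, hi⟩ := exists_ne_of_denseRange hdense hiso a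
    exact ⟨(a, i), exampleMap_of_ne hi⟩
  · exact ⟨(z i, i), exampleMap_of_eq rfl⟩

lemma isOpen_replacePoints [T1Space Z] {U : Set Z} {F : Finset ℕ} (hU : IsOpen U)
    (hF : ∀ i ∈ F, z i ∈ U) : IsOpen (replacePoints z U F) := by
  rw [isOpen_exampleSpace_iff]
  intro j
  by_cases hj : j ∈ F
  · -- the slice at `j ∈ F` misses the `z i` with `i ∈ F` that differ from `z j`
    have : {a | exampleMap z (a, j) ∈ replacePoints z U F} = U \ (z '' F \ {z j}) := by
      ext a
      by_cases ha : a = z j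
      · rw [mem_ofPred, exampleMap_of_eq ha]
        exact inr_mem_replacePoints.trans (by simp [ha, hj, hF])
      · rw [mem_ofPred, exampleMap_of_ne ha]
        exact inl_mem_replacePoints.trans (by simp [ha])
    rw [this]
    exact hU.sdiff ((F.finite_toSet.image z).sdiff).isClosed
  · have : {a | exampleMap z (a, j) ∈ replacePoints z U F} = U \ (z '' F ∪ {z j}) := by
      ext a
      by_cases ha : a = z j
      · rw [mem_ofPred, exampleMap_of_eq ha]
        exact inr_mem_replacePoints.trans (by simp [ha, hj])
      · rw [mem_ofPred, exampleMap_of_ne ha]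
        exact inl_mem_replacePoints.trans (by simp [ha])
    rw [this]
    exact hU.sdiff ((F.finite_toSet.image z).union (finite_singleton _)).isClosed

variable [T2Space Z] (hdense : DenseRange z) (hiso : ∀ n, ¬ IsOpen ({z n} : Set Z))

include hdense hiso in
lemma isTopologicalBasis_replacePoints :
    TopologicalSpace.IsTopologicalBasis {V | ∃ (U : Set Z) (F : Finset ℕ), IsOpen U ∧
      (∀ i ∈ F, z i ∈ U) ∧ V = replacePoints z U F} := by
  refine TopologicalSpace.isTopologicalBasis_of_isOpen_of_nhds ?_ ?_
  · rintro _ ⟨U, F, hU, hF, rfl⟩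
    exact isOpen_replacePoints hU hF
  · rintro (a | i) V hp hV
    · obtain ⟨j, hj⟩ := exists_ne_of_denseRange hdense hiso a
      refine ⟨_, ⟨{a | exampleMap z (a, j) ∈ V} \ {z j}, ∅, ?_, by simp, rfl⟩, ?_, ?_⟩
      · exact (isOpen_exampleSpace_iff.1 hV j).sdiff isClosed_singleton
      · refine inl_mem_replacePoints.2 ⟨⟨?_, hj⟩, by simp⟩
        rw [mem_ofPred, exampleMap_of_ne hj]; exact hp
      · rintro (b | k) hb
        · obtain ⟨⟨hb, hbj⟩, -⟩ := inl_mem_replacePoints.1 hb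
          rwa [mem_ofPred, exampleMap_of_ne hbj] at hb
        · simpa using inr_mem_replacePoints.1 hb
    · have hi : exampleMap z (z i, i) ∈ V := by rw [exampleMap_of_eq rfl]; exact hp
      refine ⟨_, ⟨{a | exampleMap z (a, i) ∈ V}, {i}, isOpen_exampleSpace_iff.1 hV i, ?_, rfl⟩,
        inr_mem_replacePoints.2 (by simp), ?_⟩
      · simpa using hi
      · rintro (b | k) hb
        · obtain ⟨hb, hbj⟩ := inl_mem_replacePoints.1 hb
          have := exampleMap_of_ne (hbj i (by simp)).symm
          rwa [mem_ofPred, this] at hb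
        · obtain rfl : k = i := by simpa using inr_mem_replacePoints.1 hb
          exact hp

/-- The sheets `Z × {i}` embed into `Y` as open subsets, and they cover `Y`: this is why `Y` inherits
the local properties of `Z`. -/
lemma isOpenEmbedding_exampleMap_slice (i : ℕ) :
    IsOpenEmbedding fun a : Z => exampleMap z (a, i) := by
  refine .of_continuous_injective_isOpenMap ?_ ?_ ?_
  · exact (continuous_coinduced_rng (f := exampleMap z)).comp (by fun_prop : Continuous fun a : Z => (a, i))
  · intro a b hab
    exact ((exampleMap_eq_iff _ _).1 hab).1
  · intro U hU
    by_cases hi : z i ∈ U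
    · convert! isOpen_replacePoints (z := z) (F := {i}) hU (by simpa using hi)
      ext (a | k)
      · refine Iff.trans ?_ inl_mem_replacePoints.symm
        constructor
        · rintro ⟨b, hb, h⟩
          obtain ⟨h1, rfl⟩ := exampleMap_eq_inl_iff.1 h
          exact ⟨hb, by simpa using Ne.symm h1⟩
        · rintro ⟨hb, h⟩
          exact ⟨a, hb, exampleMap_of_ne (h i (by simp)).symm⟩
      · refine Iff.trans ?_ inr_mem_replacePoints.symm
        simp only [Finset.mem_singleton]
        constructor
        · rintro ⟨b, hb, h⟩
          exact (exampleMap_eq_inr_iff.1 h).2.symm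
        · rintro rfl
          exact ⟨_, hi, exampleMap_of_eq rfl⟩
    · convert! isOpen_replacePoints (z := z) (F := ∅) hU (by simp)
      ext (a | k)
      · refine Iff.trans ?_ inl_mem_replacePoints.symm
        constructor
        · rintro ⟨b, hb, h⟩
          obtain ⟨h1, rfl⟩ := exampleMap_eq_inl_iff.1 h
          exact ⟨hb, by simp⟩
        · rintro ⟨hb, h⟩
          exact ⟨a, hb, exampleMap_of_ne fun h => hi (h ▸ hb)⟩
      · refine Iff.trans ?_ inr_mem_replacePoints.symm
        simp only [Finset.notMem_empty, iff_false]
        rintro ⟨b, hb, h⟩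
        exact hi ((exampleMap_eq_inr_iff.1 h).1 ▸ hb)

include hdense hiso in
lemma locallyCompactHausdorff_exampleSpace [LocallyCompactSpace Z] :
    LocallyCompactHausdorff (ExampleSpace z) := by
  intro y
  obtain ⟨⟨a, i⟩, rfl⟩ := (isQuotientMap_exampleMap hdense hiso).surjective y
  obtain ⟨K, hK, ha⟩ := exists_compact_mem_nhds a
  have he := isOpenEmbedding_exampleMap_slice (z := z) i
  refine ⟨_, he.isOpenMap.image_mem_nhds ha, hK.image he.continuous, ?_⟩
  exact (he.isEmbedding.homeomorphImage K).t2Space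

include hdense hiso in
lemma hausdorffPoints_exampleSpace :
    hausdorffPoints (ExampleSpace z) = (Sum.inl '' (Set.range z)ᶜ : Set (Z ⊕ ℕ)) := by
  have hb := isTopologicalBasis_replacePoints hdense hiso
  -- `z i` and `i` have no disjoint neighbourhoods, as `z i` is not isolated
  have key : ∀ (i : ℕ) (U V : Set (ExampleSpace z)), IsOpen U → IsOpen V →
      (Sum.inl (z i) : Z ⊕ ℕ) ∈ U → (Sum.inr i : Z ⊕ ℕ) ∈ V → ¬ Disjoint U V := by
    intro i U V hU hV hiU hiV hd
    obtain ⟨j, hj⟩ := exists_ne_of_denseRange hdense hiso (z i)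
    have h1 : {a | exampleMap z (a, j) ∈ U} ∩ {z j}ᶜ ∩ {a | exampleMap z (a, i) ∈ V} ∈ 𝓝 (z i) := by
      refine inter_mem (inter_mem ((isOpen_exampleSpace_iff.1 hU j).mem_nhds ?_)
        (isOpen_compl_singleton.mem_nhds hj)) ((isOpen_exampleSpace_iff.1 hV i).mem_nhds ?_)
      · rw [mem_ofPred, exampleMap_of_ne hj]; exact hiU
      · rw [mem_ofPred, exampleMap_of_eq rfl]; exact hiV
    have : (𝓝[≠] (z i)).NeBot := by
      rw [neBot_iff, Ne, ← isOpen_singleton_iff_punctured_nhds]; exact hiso i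
    obtain ⟨a, ha, ⟨haU, haj⟩, haV⟩ := this.nonempty_of_mem (inter_mem_nhdsWithin ({z i}ᶜ) h1)
    rw [mem_ofPred, exampleMap_of_ne haj] at haU
    rw [mem_ofPred, exampleMap_of_ne ha] at haV
    exact Set.disjoint_left.1 hd haU haV
  ext (a | i)
  · constructor
    · intro h
      refine ⟨a, ?_, rfl⟩
      rintro ⟨i, rfl⟩
      obtain ⟨U, V, hU, hV, h1, h2, h3⟩ := h (Sum.inr i : Z ⊕ ℕ) Sum.inr_ne_inl
      exact key i U V hU hV h1 h2 h3
    · rintro ⟨b, hb, h⟩ y hy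
      obtain rfl : b = a := Sum.inl_injective h
      rcases y with c | i
      · have hbc : b ≠ c := fun h => hy (by rw [h])
        obtain ⟨U, V, hU, hV, hbU, hcV, hd⟩ := t2_separation hbc
        refine ⟨_, _, isOpen_replacePoints (z := z) (F := ∅) hU (by simp),
          isOpen_replacePoints (z := z) (F := ∅) hV (by simp),
          inl_mem_replacePoints.2 ⟨hbU, by simp⟩, inl_mem_replacePoints.2 ⟨hcV, by simp⟩, ?_⟩
        rw [Set.disjoint_left]
        rintro (d | k) h1 h2
        · exact Set.disjoint_left.1 hd (inl_mem_replacePoints.1 h1).1 (inl_mem_replacePoints.1 h2).1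
        · simpa using inr_mem_replacePoints.1 h1
      · have hbc : b ≠ z i := fun h => hb ⟨i, h.symm⟩
        obtain ⟨U, V, hU, hV, hbU, hcV, hd⟩ := t2_separation hbc
        refine ⟨_, _, isOpen_replacePoints (z := z) (F := ∅) hU (by simp),
          isOpen_replacePoints (z := z) (F := {i}) hV (by simpa using hcV),
          inl_mem_replacePoints.2 ⟨hbU, by simp⟩, inr_mem_replacePoints.2 (by simp), ?_⟩
        rw [Set.disjoint_left]
        rintro (d | k) h1 h2
        · exact Set.disjoint_left.1 hd (inl_mem_replacePoints.1 h1).1 (inl_mem_replacePoints.1 h2).1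
        · simpa using inr_mem_replacePoints.1 h1
  · constructor
    · intro h
      obtain ⟨U, V, hU, hV, h1, h2, h3⟩ := h (Sum.inl (z i) : Z ⊕ ℕ) Sum.inl_ne_inr
      exact (key i V U hV hU h2 h1 h3.symm).elim
    · rintro ⟨b, hb, h⟩
      exact (Sum.inl_ne_inr h).elim

include hdense hiso in
lemma interior_hausdorffPoints_exampleSpace :
    interior (hausdorffPoints (ExampleSpace z)) = ∅ := by
  rw [hausdorffPoints_exampleSpace hdense hiso, Set.eq_empty_iff_forall_notMem]
  intro y hy
  obtain ⟨⟨a, i⟩, rfl⟩ := (isQuotientMap_exampleMap hdense hiso).surjective y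
  obtain ⟨_, h, k, rfl⟩ := hdense.inter_open_nonempty _
    (isOpen_exampleSpace_iff.1 (isOpen_interior
      (s := (Sum.inl '' (Set.range z)ᶜ : Set (ExampleSpace z)))) i) ⟨a, hy⟩
  obtain ⟨b, hb, hbk⟩ := interior_subset h
  exact hb ⟨k, (exampleMap_eq_inl_iff.1 hbk.symm).2⟩

end ExampleTopology

/-! ### The equivalence relation `R` is étale -/

section ExampleEtale

variable {Z : Type u} {z : ℕ → Z} [TopologicalSpace Z]

lemma isOpen_exampleRel [T1Space Z] : IsOpen (exampleRel z) := by
  rw [isOpen_iff_mem_nhds]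
  rintro ⟨a, ij⟩ h
  rw [nhds_prod_eq, nhds_discrete (ℕ × ℕ), prod_pure, Filter.mem_map]
  by_cases hij : ij.1 = ij.2
  · exact Filter.mem_of_superset univ_mem fun b _ _ => hij
  · have ha : a ∉ ({z ij.1, z ij.2} : Set Z) := fun h' => hij (h h')
    exact Filter.mem_of_superset ((Set.toFinite _).isClosed.isOpen_compl.mem_nhds ha)
      fun b hb hb' => (hb hb').elim

lemma isEmbedding_exampleRel :
    IsEmbedding (fun p : exampleRel z => ((p.1.1, p.1.2.1), (p.1.1, p.1.2.2))) := by
  refine .of_comp (g := fun q : (Z × ℕ) × (Z × ℕ) => (q.1.1, (q.1.2, q.2.2))) (by fun_prop)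
    (by fun_prop) ?_
  exact .subtypeVal

omit [TopologicalSpace Z] in
lemma range_exampleRel :
    Set.range (fun p : exampleRel z => ((p.1.1, p.1.2.1), (p.1.1, p.1.2.2))) =
      {q | exampleSetoid z q.1 q.2} := by
  ext ⟨⟨a, i⟩, ⟨b, j⟩⟩
  constructor
  · rintro ⟨⟨⟨c, k, l⟩, h⟩, he⟩
    simp only [Prod.mk.injEq] at he
    obtain ⟨⟨rfl, rfl⟩, rfl, rfl⟩ := he
    exact ⟨rfl, h⟩
  · rintro ⟨h : a = b, h'⟩
    subst h
    exact ⟨⟨(a, (i, j)), h'⟩, rfl⟩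

lemma isEtaleRel_exampleSetoid [T1Space Z] : IsEtaleRel (exampleSetoid z) := by
  have he : IsOpenEmbedding fun γ : RelGraph (exampleSetoid z) =>
      (γ.1.1.1, (γ.1.1.2, γ.1.2.2)) := by
    refine ⟨.of_comp (g := fun p : Z × (ℕ × ℕ) => ((p.1, p.2.1), (p.1, p.2.2))) (by fun_prop)
      (by fun_prop) ?_, ?_⟩
    · have : ((fun p : Z × (ℕ × ℕ) => ((p.1, p.2.1), (p.1, p.2.2))) ∘
          fun γ : RelGraph (exampleSetoid z) => (γ.1.1.1, (γ.1.1.2, γ.1.2.2))) = Subtype.val :=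
        funext fun γ => Prod.ext rfl (Prod.ext γ.2.1 rfl)
      rw [this]
      exact .subtypeVal
    · convert! isOpen_exampleRel (z := z)
      ext ⟨a, i, j⟩
      constructor
      · rintro ⟨⟨⟨⟨b, k⟩, ⟨c, l⟩⟩, h⟩, he⟩
        simp only [Prod.mk.injEq] at he
        obtain ⟨rfl, rfl, rfl⟩ := he
        exact h.2
      · intro h
        exact ⟨⟨((a, i), (a, j)), rfl, h⟩, rfl⟩
  have key : ∀ g : ℕ × ℕ → ℕ, IsLocalHomeomorph fun p : Z × (ℕ × ℕ) => (p.1, g p.2) := by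
    intro g
    rw [isLocalHomeomorph_iff_isOpenEmbedding_restrict]
    rintro ⟨a, ij⟩
    refine ⟨Prod.snd ⁻¹' {ij}, ((isOpen_discrete {ij}).preimage continuous_snd).mem_nhds rfl, ?_⟩
    refine .of_continuous_injective_isOpenMap ?_ ?_ ?_
    · exact (continuous_fst.prodMk (continuous_of_discreteTopology.comp continuous_snd)).comp
        continuous_subtype_val
    · rintro ⟨p, hp⟩ ⟨q, hq⟩ h
      exact Subtype.ext (Prod.ext (congrArg (fun x : Z × ℕ => x.1) h) (hp.trans hq.symm))
    · refine IsOpenMap.domRestrict ?_ ((isOpen_discrete {ij}).preimage continuous_snd)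
      exact IsOpenMap.id.prodMap (fun s _ => isOpen_discrete _)
  refine ⟨(key Prod.fst).comp he.isLocalHomeomorph, ?_⟩
  convert! (key Prod.snd).comp he.isLocalHomeomorph using 1
  funext γ
  exact Prod.ext γ.2.1.symm rfl

end ExampleEtale

/-! ### Elements of the convolution algebra -/

section ConvolutionTools

variable {X : Type u} [TopologicalSpace X] {r : Setoid X} {hr : IsEtaleRel r}

namespace IsEtaleRel

/-- Since the graph carries the topology induced by `X × X`, the diagonal is open in it: every point
has a neighbourhood in which no two distinct points are equivalent. -/
lemma exists_isOpen_transversal (hr : IsEtaleRel r) (x : X) :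
    ∃ U : Set X, IsOpen U ∧ x ∈ U ∧ ∀ y ∈ U, ∀ w ∈ U, r y w → y = w := by
  obtain ⟨N, hN, hxN, hinj⟩ := hr.1.isLocallyInjective ⟨(x, x), r.refl x⟩
  obtain ⟨N', hN', rfl⟩ := isOpen_induced_iff.1 hN
  obtain ⟨U, V, hU, hV, hxU, hxV, hUV⟩ := isOpen_prod_iff.1 hN' x x hxN
  refine ⟨U ∩ V, hU.inter hV, ⟨hxU, hxV⟩, fun y hy w hw hyw => ?_⟩
  have := @hinj ⟨(y, y), r.refl y⟩ (hUV ⟨hy.1, hy.2⟩) ⟨(y, w), hyw⟩ (hUV ⟨hy.1, hw.2⟩) rfl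
  exact congrArg (fun γ : RelGraph r => γ.1.2) this

lemma isOpen_diagonal (hr : IsEtaleRel r) : IsOpen {γ : RelGraph r | γ.1.1 = γ.1.2} := by
  rw [isOpen_iff_mem_nhds]
  rintro ⟨⟨x, y⟩, hxy⟩ (rfl : x = y)
  obtain ⟨U, hU, hxU, h⟩ := hr.exists_isOpen_transversal x
  have : (fun γ : RelGraph r => γ.1.1) ⁻¹' U ∩ (fun γ : RelGraph r => γ.1.2) ⁻¹' U ∈
      𝓝 (⟨(x, x), hxy⟩ : RelGraph r) :=
    ((hU.preimage (by fun_prop)).inter (hU.preimage (by fun_prop))).mem_nhds ⟨hxU, hxU⟩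
  exact Filter.mem_of_superset this fun γ hγ => h _ hγ.1 _ hγ.2 γ.2

lemma locallyCompactSpace_relGraph [T2Space X] [LocallyCompactSpace X] (hr : IsEtaleRel r) :
    LocallyCompactSpace (RelGraph r) := by
  have : WeaklyLocallyCompactSpace (RelGraph r) := by
    refine ⟨fun γ => ?_⟩
    obtain ⟨N, hN, he⟩ := isLocalHomeomorph_iff_isOpenEmbedding_restrict.1 hr.1 γ
    have := he.locallyCompactSpace
    obtain ⟨K, hK, hγK⟩ := exists_compact_mem_nhds (⟨γ, mem_of_mem_nhds hN⟩ : N)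
    refine ⟨Subtype.val '' K, hK.image continuous_subtype_val, ?_⟩
    rw [← map_nhds_subtype_coe_eq_nhds (mem_of_mem_nhds hN) hN]
    exact image_mem_map hγK
  infer_instance

end IsEtaleRel

namespace ConvAlg

section diag

variable [T2Space X]

open Classical in
/-- A compactly supported continuous function on `X`, seen as an element of `C_c(R)` that is
supported by the diagonal. -/
noncomputable def diag (hr : IsEtaleRel r) (h : C(X, ℂ)) (hc : HasCompactSupport h) :
    ConvAlg r hr where
  toFun γ := if γ.1.1 = γ.1.2 then h γ.1.1 else 0
  continuous_toFun := by
    have hcl : IsClopen {γ : RelGraph r | γ.1.1 = γ.1.2} :=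
      ⟨isClosed_eq (by fun_prop) (by fun_prop), hr.isOpen_diagonal⟩
    refine Continuous.if (fun γ hγ => ?_) (by fun_prop) continuous_const
    rw [hcl.frontier_eq] at hγ
    exact hγ.elim
  hasCompactSupport_toFun := by
    refine HasCompactSupport.intro (hc.isCompact.image
      (f := fun x => (⟨(x, x), r.refl x⟩ : RelGraph r)) (by fun_prop)) ?_
    rintro ⟨⟨x, y⟩, hxy⟩ hγ
    by_cases he : x = y
    · subst he
      simp only [if_true]
      by_contra hne
      exact hγ ⟨x, subset_tsupport _ hne, rfl⟩
    · simp [he]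

variable {h : C(X, ℂ)} {hc : HasCompactSupport h}

lemma coeff_diag_self (x : X) : (diag hr h hc).coeff x x = h x := by
  rw [coeff_of_rel _ (r.refl x)]
  exact if_pos rfl

lemma coeff_diag_of_ne {x y : X} (hxy : x ≠ y) : (diag hr h hc).coeff x y = 0 := by
  by_cases hr' : r x y
  · rw [coeff_of_rel _ hr']
    exact if_neg hxy
  · exact coeff_of_not_rel _ hr'

lemma coeff_diag_mul (f : ConvAlg r hr) (x y : X) :
    (diag hr h hc * f).coeff x y = h x * f.coeff x y := by
  rw [coeff_mul, convFun, finsum_eq_single _ x, coeff_diag_self]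
  intro w hw
  rw [coeff_diag_of_ne hw.symm, zero_mul]

lemma coeff_mul_diag (f : ConvAlg r hr) (x y : X) :
    (f * diag hr h hc).coeff x y = f.coeff x y * h y := by
  rw [coeff_mul, convFun, finsum_eq_single _ y, coeff_diag_self]
  intro w hw
  rw [coeff_diag_of_ne hw, mul_zero]

end diag

section INorm

variable [T2Space X]

lemma finite_coeff_left (f : ConvAlg r hr) (y : X) : {w | f.coeff w y ≠ 0}.Finite := by
  simpa using (star f).finite_coeff y

omit [T2Space X] in
lemma INorm_nonneg (f : ConvAlg r hr) : 0 ≤ INorm f :=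
  le_max_of_le_left (Real.iSup_nonneg fun _ => finsum_nonneg fun _ => norm_nonneg _)

lemma sum_norm_coeff_right_le (f : ConvAlg r hr) (x : X) (S : Finset X) :
    ∑ y ∈ S, ‖f.coeff x y‖ ≤ INorm f := by
  classical
  calc ∑ y ∈ S, ‖f.coeff x y‖ ≤ ∑ y ∈ S ∪ (f.finite_coeff x).toFinset, ‖f.coeff x y‖ :=
        Finset.sum_le_sum_of_subset_of_nonneg Finset.subset_union_left fun _ _ _ => norm_nonneg _
    _ = ∑ᶠ y, ‖f.coeff x y‖ := by
        refine (finsum_eq_sum_of_support_subset _ fun y hy => ?_).symm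
        have hy' : f.coeff x y ≠ 0 := norm_ne_zero_iff.1 hy
        simp [hy']
    _ ≤ INorm f := (le_ciSup f.bddAbove_sum_norm_coeff.1 x).trans (le_max_left _ _)

lemma sum_norm_coeff_left_le (f : ConvAlg r hr) (y : X) (S : Finset X) :
    ∑ x ∈ S, ‖f.coeff x y‖ ≤ INorm f := by
  classical
  calc ∑ x ∈ S, ‖f.coeff x y‖ ≤ ∑ x ∈ S ∪ (f.finite_coeff_left y).toFinset, ‖f.coeff x y‖ :=
        Finset.sum_le_sum_of_subset_of_nonneg Finset.subset_union_left fun _ _ _ => norm_nonneg _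
    _ = ∑ᶠ x, ‖f.coeff x y‖ := by
        refine (finsum_eq_sum_of_support_subset _ fun x hx => ?_).symm
        have hy' : f.coeff x y ≠ 0 := norm_ne_zero_iff.1 hx
        simp [hy']
    _ ≤ INorm f :=
        (le_ciSup f.bddAbove_sum_norm_coeff.2 y).trans (le_max_right _ _)

lemma norm_le_INorm (f : ConvAlg r hr) : ‖f‖ ≤ INorm f :=
  Real.iSup_le (fun p => p.2.le_INorm f) (INorm_nonneg f)

lemma INorm_le_of_norm_coeff_le {f g : ConvAlg r hr} {c : ℝ} (hc : 0 ≤ c)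
    (h : ∀ x y, ‖g.coeff x y‖ ≤ c * ‖f.coeff x y‖) : INorm g ≤ c * INorm f := by
  have h0 := mul_nonneg hc (INorm_nonneg f)
  refine max_le (Real.iSup_le (fun x => ?_) h0) (Real.iSup_le (fun x => ?_) h0)
  · rw [finsum_eq_sum_of_support_subset (s := (g.finite_coeff x).toFinset)]
    · refine (Finset.sum_le_sum fun y _ => h x y).trans ?_
      rw [← Finset.mul_sum]
      exact mul_le_mul_of_nonneg_left (f.sum_norm_coeff_right_le x _) hc
    · intro y hy
      have hy' : g.coeff x y ≠ 0 := norm_ne_zero_iff.1 hy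
      simp [hy']
  · rw [finsum_eq_sum_of_support_subset (s := (g.finite_coeff_left x).toFinset)]
    · refine (Finset.sum_le_sum fun y _ => h y x).trans ?_
      rw [← Finset.mul_sum]
      exact mul_le_mul_of_nonneg_left (f.sum_norm_coeff_left_le x _) hc
    · intro y hy
      have hy' : g.coeff y x ≠ 0 := norm_ne_zero_iff.1 hy
      simp [hy']

lemma norm_diag_le {h : C(X, ℂ)} {hc : HasCompactSupport h} {c : ℝ} (h0 : 0 ≤ c)
    (hle : ∀ x, ‖h x‖ ≤ c) : ‖diag hr h hc‖ ≤ c := by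
  refine (norm_le_INorm _).trans (max_le (Real.iSup_le (fun x => ?_) h0)
    (Real.iSup_le (fun x => ?_) h0))
  · rw [finsum_eq_single _ x, coeff_diag_self]
    · exact hle x
    · intro y hy
      rw [coeff_diag_of_ne hy.symm, norm_zero]
  · rw [finsum_eq_single _ x, coeff_diag_self]
    · exact hle x
    · intro y hy
      rw [coeff_diag_of_ne hy, norm_zero]

end INorm

section Urysohn

variable [T2Space X] [LocallyCompactSpace X]

/-- Urysohn's lemma on the graph: at a prescribed arrow `γ`, an element of `C_c(R)` with value `1` and
support in a given neighbourhood. -/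
lemma exists_toFun_eq_one (γ : RelGraph r) {N : Set (RelGraph r)} (hN : N ∈ 𝓝 γ) :
    ∃ f : ConvAlg r hr, f.toFun γ = 1 ∧ ∀ δ ∉ N, f.toFun δ = 0 := by
  have := hr.locallyCompactSpace_relGraph
  obtain ⟨f, hf1, hf0, hfc, -⟩ := exists_continuous_one_zero_of_isCompact
    (isCompact_singleton (x := γ)) (isClosed_compl_iff.2 (isOpen_interior (s := N)))
    (by simpa [mem_interior_iff_mem_nhds] using hN)
  refine ⟨⟨fun δ => (f δ : ℂ), by fun_prop, ?_⟩, ?_, fun δ hδ => ?_⟩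
  · exact hfc.comp_left (g := fun t : ℝ => (t : ℂ)) (by simp)
  · simpa using hf1 rfl
  · simpa using hf0 (fun h => hδ (interior_subset h))

/-- Matrix units: on the equivalence class of `x`, every pair of points carries the matrix unit as
the restriction of some element of `C_c(R)`. -/
lemma exists_matrixUnit (hr : IsEtaleRel r) {y w : X} (hyw : r y w) : ∃ f : ConvAlg r hr,
    f.coeff y w = 1 ∧ ∀ y' w', r y y' → (y' ≠ y ∨ w' ≠ w) → f.coeff y' w' = 0 := by
  obtain ⟨U, hU, hyU, hU'⟩ := hr.exists_isOpen_transversal y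
  obtain ⟨V, hV, hwV, hV'⟩ := hr.exists_isOpen_transversal w
  have hN : (fun γ : RelGraph r => γ.1.1) ⁻¹' U ∩ (fun γ : RelGraph r => γ.1.2) ⁻¹' V ∈
      𝓝 (⟨(y, w), hyw⟩ : RelGraph r) :=
    ((hU.preimage (by fun_prop)).inter (hV.preimage (by fun_prop))).mem_nhds ⟨hyU, hwV⟩
  obtain ⟨f, hf1, hf0⟩ := exists_toFun_eq_one (hr := hr) ⟨(y, w), hyw⟩ hN
  refine ⟨f, by rw [coeff_of_rel _ hyw, hf1], fun y' w' hy' hne => ?_⟩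
  by_cases hrel : r y' w'
  · rw [coeff_of_rel _ hrel]
    refine hf0 _ fun hmem => ?_
    have h1 : y' = y := hU' _ hmem.1 _ hyU (r.symm hy')
    have h2 : w' = w := hV' _ hmem.2 _ hwV (r.trans (r.symm hrel) (r.trans (r.symm hy') hyw))
    exact hne.elim (fun h => h h1) (fun h => h h2)
  · exact coeff_of_not_rel _ hrel

end Urysohn

end ConvAlg

end ConvolutionTools

/-! ### The regular representations -/

section RegularRepresentation

variable {X : Type u} [TopologicalSpace X] [T2Space X] {r : Setoid X} {hr : IsEtaleRel r}

/-- The Hilbert space `ℓ²` of the equivalence class of `x`. -/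
abbrev OrbitSpace (r : Setoid X) (x : X) : Type u := lp (fun _ : {y // r x y} => ℂ) 2

open Classical in
/-- The standard basis vectors of `ℓ²` of an equivalence class. -/
noncomputable def orbitBasis {x : X} (y : {y // r x y}) : OrbitSpace r x := lp.single 2 y (1 : ℂ)

section basis

omit [TopologicalSpace X] [T2Space X]

variable {x : X}

lemma orbitBasis_apply_self (y : {y // r x y}) : orbitBasis y y = 1 := by
  classical
  simp [orbitBasis]

lemma orbitBasis_apply_of_ne {y w : {y // r x y}} (h : w ≠ y) : orbitBasis y w = 0 := by
  classical
  simp [orbitBasis, lp.single_apply, h]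

lemma inner_orbitBasis (y : {y // r x y}) (ξ : OrbitSpace r x) :
    inner ℂ (orbitBasis y) ξ = ξ y := by
  classical
  simp [orbitBasis, lp.inner_single_left]

lemma norm_orbitBasis (y : {y // r x y}) : ‖orbitBasis y‖ = 1 := by
  rw [← sq_eq_sq₀ (norm_nonneg _) zero_le_one, ← @inner_self_eq_norm_sq ℂ, inner_orbitBasis,
    orbitBasis_apply_self]
  simp

lemma orbitSpace_ext {S T : OrbitSpace r x →L[ℂ] OrbitSpace r x}
    (h : ∀ y w, S (orbitBasis w) y = T (orbitBasis w) y) : S = T := by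
  classical
  refine lp.ext_continuousLinearMap ENNReal.ofNat_ne_top fun i => ?_
  ext
  exact h _ i

/-- Finite sums of squares of coordinates are bounded by the norm. -/
lemma sum_norm_sq_le (ξ : OrbitSpace r x) (S : Finset {y // r x y}) :
    ∑ y ∈ S, ‖ξ y‖ ^ 2 ≤ ‖ξ‖ ^ 2 := by
  have := lp.sum_rpow_le_norm_rpow (p := 2) (by simp) ξ S
  simpa using this

end basis

namespace ConvAlg

/-- The function that underlies `λ_x(f) ξ`, where `λ_x` is the regular representation on `ℓ²` of the
equivalence class of `x`. -/
noncomputable def regFun (f : ConvAlg r hr) {x : X} (ξ : {y // r x y} → ℂ) (y : {y // r x y}) : ℂ :=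
  ∑ᶠ w : {y // r x y}, f.coeff y w * ξ w

lemma exists_finset_orbit (f : ConvAlg r hr) {x : X} (y : {y // r x y}) :
    ∃ A : Finset {y // r x y}, ∀ w : {y // r x y}, f.coeff y w ≠ 0 ↔ w ∈ A :=
  ⟨((f.finite_coeff y).preimage (Subtype.val_injective.injOn)).toFinset, fun w => by simp⟩

omit [T2Space X] in
lemma regFun_eq_sum (f : ConvAlg r hr) {x : X} (ξ : {y // r x y} → ℂ) (y : {y // r x y})
    (A : Finset {y // r x y}) (hA : ∀ w : {y // r x y}, f.coeff y w ≠ 0 → w ∈ A) :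
    f.regFun ξ y = ∑ w ∈ A, f.coeff y w * ξ w := by
  refine finsum_eq_sum_of_support_subset _ fun w hw => hA w fun h => hw ?_
  simp [h]

lemma regFun_add (f : ConvAlg r hr) {x : X} (ξ η : {y // r x y} → ℂ) :
    f.regFun (ξ + η) = f.regFun ξ + f.regFun η := by
  funext y
  obtain ⟨A, hA⟩ := f.exists_finset_orbit y
  rw [Pi.add_apply]
  simp_rw [f.regFun_eq_sum _ y A fun w => (hA w).1]
  simp [mul_add, Finset.sum_add_distrib]

lemma regFun_smul (f : ConvAlg r hr) {x : X} (c : ℂ) (ξ : {y // r x y} → ℂ) :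
    f.regFun (c • ξ) = c • f.regFun ξ := by
  funext y
  obtain ⟨A, hA⟩ := f.exists_finset_orbit y
  rw [Pi.smul_apply]
  simp_rw [f.regFun_eq_sum _ y A fun w => (hA w).1]
  simp [Finset.mul_sum, mul_left_comm]

/-- Schur's test: the matrix of `f` is bounded on `ℓ²` by the `I`-norm, by the Cauchy–Schwarz
inequality with respect to the weights `|f(y, w)|`. -/
lemma sum_norm_regFun_sq_le (f : ConvAlg r hr) {x : X} (ξ : OrbitSpace r x)
    (S : Finset {y // r x y}) : ∑ y ∈ S, ‖f.regFun ξ y‖ ^ 2 ≤ (INorm f * ‖ξ‖) ^ 2 := by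
  classical
  choose A hA using fun y : {y // r x y} => f.exists_finset_orbit y
  set B := S.biUnion A
  have hrow : ∀ y : {y // r x y}, ∑ w ∈ B, ‖f.coeff y w‖ ≤ INorm f := fun y => by
    simpa using f.sum_norm_coeff_right_le y (B.map (Function.Embedding.subtype _))
  have hcol : ∀ w : {y // r x y}, ∑ y ∈ S, ‖f.coeff y w‖ ≤ INorm f := fun w => by
    simpa using f.sum_norm_coeff_left_le w (S.map (Function.Embedding.subtype _))
  have h0 := f.INorm_nonneg
  have hpt : ∀ y ∈ S, ‖f.regFun ξ y‖ ^ 2 ≤ INorm f * ∑ w ∈ B, ‖f.coeff y w‖ * ‖ξ w‖ ^ 2 := by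
    intro y hy
    rw [f.regFun_eq_sum ξ y B
      fun w hw => Finset.mem_biUnion.2 ⟨y, hy, (hA y w).1 hw⟩]
    calc ‖∑ w ∈ B, f.coeff y w * ξ w‖ ^ 2 ≤ (∑ w ∈ B, ‖f.coeff y w‖ * ‖ξ w‖) ^ 2 := by
          gcongr
          exact (norm_sum_le _ _).trans (by simp)
      _ ≤ (∑ w ∈ B, ‖f.coeff y w‖) * ∑ w ∈ B, ‖f.coeff y w‖ * ‖ξ w‖ ^ 2 := by
          refine Finset.sum_sq_le_sum_mul_sum_of_sq_le_mul _ (fun _ _ => norm_nonneg _)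
            (fun _ _ => by positivity) fun w _ => le_of_eq (by ring)
      _ ≤ _ := by
          gcongr
          exact hrow y
  calc ∑ y ∈ S, ‖f.regFun ξ y‖ ^ 2
      ≤ ∑ y ∈ S, INorm f * ∑ w ∈ B, ‖f.coeff y w‖ * ‖ξ w‖ ^ 2 := Finset.sum_le_sum hpt
    _ = INorm f * ∑ w ∈ B, (∑ y ∈ S, ‖f.coeff y w‖) * ‖ξ w‖ ^ 2 := by
        rw [← Finset.mul_sum, Finset.sum_comm]
        simp_rw [Finset.sum_mul]
    _ ≤ INorm f * ∑ w ∈ B, INorm f * ‖ξ w‖ ^ 2 := by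
        gcongr with w _
        exact hcol w
    _ ≤ INorm f * (INorm f * ‖ξ‖ ^ 2) := by
        rw [← Finset.mul_sum]
        gcongr
        exact sum_norm_sq_le ξ B
    _ = _ := by ring

lemma memℓp_regFun (f : ConvAlg r hr) {x : X} (ξ : OrbitSpace r x) :
    Memℓp (f.regFun ξ) 2 :=
  memℓp_gen' (C := (INorm f * ‖ξ‖) ^ 2) fun S => by simpa using f.sum_norm_regFun_sq_le ξ S

/-- The operator `λ_x(f)` on `ℓ²` of the equivalence class of `x`. -/
noncomputable def regOp (x : X) (f : ConvAlg r hr) : OrbitSpace r x →L[ℂ] OrbitSpace r x :=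
  LinearMap.mkContinuous
    { toFun := fun ξ => ⟨f.regFun ξ, f.memℓp_regFun ξ⟩
      map_add' := fun ξ η => lp.ext (f.regFun_add ξ η)
      map_smul' := fun c ξ => lp.ext (f.regFun_smul c ξ) }
    (INorm f) fun ξ =>
      lp.norm_le_of_forall_sum_le (by simp) (mul_nonneg f.INorm_nonneg (norm_nonneg _))
        fun S => by simpa using f.sum_norm_regFun_sq_le ξ S

lemma norm_regOp_le (x : X) (f : ConvAlg r hr) : ‖regOp x f‖ ≤ INorm f :=
  LinearMap.mkContinuous_norm_le _ f.INorm_nonneg _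

lemma regOp_apply (f : ConvAlg r hr) {x : X} (ξ : OrbitSpace r x) (y : {y // r x y}) :
    regOp x f ξ y = f.regFun ξ y := rfl

lemma regOp_orbitBasis (f : ConvAlg r hr) {x : X} (y w : {y // r x y}) :
    regOp x f (orbitBasis w) y = f.coeff y w := by
  rw [regOp_apply, regFun, finsum_eq_single _ w, orbitBasis_apply_self, mul_one]
  intro v hv
  rw [orbitBasis_apply_of_ne hv, mul_zero]

variable (hr) in
/-- The regular representation `λ_x` of `C_c(R)` on `ℓ²` of the equivalence class of `x`. -/
noncomputable def regHom (x : X) :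
    ConvAlg r hr →⋆ₙₐ[ℂ] (OrbitSpace r x →L[ℂ] OrbitSpace r x) where
  toFun := regOp x
  map_smul' c f := orbitSpace_ext fun y w => by
    change _ = c * _
    simp [regOp_orbitBasis]
  map_zero' := orbitSpace_ext fun y w => by simp [regOp_orbitBasis]
  map_add' f g := orbitSpace_ext fun y w => by
    change _ = regOp x f (orbitBasis w) y + regOp x g (orbitBasis w) y
    simp [regOp_orbitBasis]
  map_mul' f g := orbitSpace_ext fun y w => by
    obtain ⟨A, hA⟩ := f.exists_finset_orbit y
    change _ = regOp x f (regOp x g (orbitBasis w)) y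
    rw [regOp_apply f, f.regFun_eq_sum _ y A fun w => (hA w).1, regOp_orbitBasis,
      coeff_mul_eq_sum f g _ _ (A.map (Function.Embedding.subtype _))]
    · simp [regOp_orbitBasis]
    · intro v hv
      have hyv : r x v := r.trans y.2 (rel_of_coeff_ne hv)
      exact Finset.mem_map.2 ⟨⟨v, hyv⟩, (hA ⟨v, hyv⟩).1 hv, rfl⟩
  map_star' f := orbitSpace_ext fun y w => by
    rw [regOp_orbitBasis, ← inner_orbitBasis, ContinuousLinearMap.star_eq_adjoint,
      ContinuousLinearMap.adjoint_inner_right, ← inner_conj_symm, inner_orbitBasis,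
      regOp_orbitBasis, coeff_star]
    rfl

lemma regHom_orbitBasis (f : ConvAlg r hr) {x : X} (y w : {y // r x y}) :
    regHom hr x f (orbitBasis w) y = f.coeff y w := regOp_orbitBasis f y w

lemma norm_regHom_le (x : X) (f : ConvAlg r hr) : ‖regHom hr x f‖ ≤ INorm f := norm_regOp_le x f

end ConvAlg

namespace GroupoidCStar

open UniformSpace

lemma denseRange_ofConv : DenseRange (ofConv : ConvAlg r hr → GroupoidCStar r hr) :=
  isDenseInducing_ofConv.dense

/-- A `*`-representation of `C_c(R)` that is bounded by the `I`-norm is bounded by the norm of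
`C*(R)`. -/
lemma norm_le_of_norm_le_INorm {B : Type*} [NonUnitalCStarAlgebra B] (φ : ConvAlg r hr →⋆ₙₐ[ℂ] B)
    (hφ : ∀ f, ‖φ f‖ ≤ ConvAlg.INorm f) (f : ConvAlg r hr) : ‖φ f‖ ≤ ‖f‖ := by
  let p : Seminorm ℂ (ConvAlg r hr) := (normSeminorm ℂ B).comp (φ : ConvAlg r hr →ₗ[ℂ] B)
  have hp : ConvAlg.IsCStarSeminorm p :=
    { mul_le := fun f g => by
        change ‖φ (f * g)‖ ≤ ‖φ f‖ * ‖φ g‖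
        rw [map_mul]; exact norm_mul_le _ _
      star_mul_self := fun f => by
        change ‖φ (star f * f)‖ = ‖φ f‖ ^ 2
        rw [map_mul, map_star, CStarRing.norm_star_mul_self, sq]
      le_INorm := hφ }
  exact ConvAlg.le_fullNorm f ⟨p, hp⟩

/-- The universal property of `C*(R)`: the extension of a `*`-representation of `C_c(R)` that is
bounded by the `I`-norm. -/
noncomputable def lift {B : Type*} [NonUnitalCStarAlgebra B] (φ : ConvAlg r hr →⋆ₙₐ[ℂ] B)
    (hφ : ∀ f, ‖φ f‖ ≤ ConvAlg.INorm f) : GroupoidCStar r hr →⋆ₙₐ[ℂ] B :=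
  have hu : UniformContinuous φ :=
    AddMonoidHomClass.uniformContinuous_of_bound φ 1 fun f => by
      rw [one_mul]; exact norm_le_of_norm_le_INorm φ hφ f
  have hc : Continuous (Completion.extension φ) := Completion.continuous_extension
  have he : ∀ f, Completion.extension φ (ofConv f) = φ f := Completion.extension_coe hu
  { toFun := Completion.extension φ
    map_smul' := fun c a => by
      induction a using induction₁ with
      | hP => exact isClosed_eq (hc.comp (continuous_const_smul c)) (hc.const_smul _)
      | h f => rw [← ofConv_smul, he, he, map_smul]; rfl
    map_zero' := by rw [← ofConv_zero, he, map_zero]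
    map_add' := fun a b => by
      induction a, b using induction₂ with
      | hP => exact isClosed_eq (by fun_prop) (by fun_prop)
      | h f g => rw [← ofConv_add, he, he, he, map_add]
    map_mul' := fun a b => by
      induction a, b using induction₂ with
      | hP => exact isClosed_eq (by fun_prop) (by fun_prop)
      | h f g => rw [← ofConv_mul, he, he, he, map_mul]
    map_star' := fun a => by
      induction a using induction₁ with
      | hP => exact isClosed_eq (by fun_prop) (by fun_prop)
      | h f => rw [← ofConv_star, he, he, map_star] }

lemma lift_ofConv {B : Type*} [NonUnitalCStarAlgebra B] (φ : ConvAlg r hr →⋆ₙₐ[ℂ] B)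
    (hφ : ∀ f, ‖φ f‖ ≤ ConvAlg.INorm f) (f : ConvAlg r hr) : lift φ hφ (ofConv f) = φ f :=
  Completion.extension_coe (AddMonoidHomClass.uniformContinuous_of_bound φ 1 fun f => by
      rw [one_mul]; exact norm_le_of_norm_le_INorm φ hφ f) f

/-- The regular representation `λ_x` of `C*(R)`. -/
noncomputable def reg (hr : IsEtaleRel r) (x : X) :
    GroupoidCStar r hr →⋆ₙₐ[ℂ] (OrbitSpace r x →L[ℂ] OrbitSpace r x) :=
  lift (ConvAlg.regHom hr x) (ConvAlg.norm_regHom_le x)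

lemma reg_ofConv_orbitBasis (f : ConvAlg r hr) {x : X} (y w : {y // r x y}) :
    reg hr x (ofConv f) (orbitBasis w) y = f.coeff y w := by
  rw [reg, lift_ofConv, ConvAlg.regHom_orbitBasis]

lemma reg_ofConv_apply (f : ConvAlg r hr) {x : X} (ξ : OrbitSpace r x) (y : {y // r x y}) :
    reg hr x (ofConv f) ξ y = f.regFun ξ y := by
  rw [reg, lift_ofConv]; rfl

/-- An element of `C_c(R)` that restricts to the matrix unit of `(y, w)` on the class of `x` acts as
that matrix unit. -/
lemma reg_ofConv_matrixUnit {f : ConvAlg r hr} {x : X} {y w : {y // r x y}}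
    (h1 : f.coeff y w = 1)
    (h0 : ∀ y' w', r y y' → (y' ≠ (y : X) ∨ w' ≠ (w : X)) → f.coeff y' w' = 0)
    (ξ : OrbitSpace r x) : reg hr x (ofConv f) ξ = ξ w • orbitBasis y := by
  ext v
  rw [reg_ofConv_apply, ConvAlg.regFun_eq_sum f _ _ {w}]
  · rw [Finset.sum_singleton, lp.coeFn_smul, Pi.smul_apply, smul_eq_mul]
    by_cases hv : v = y
    · rw [hv, h1, orbitBasis_apply_self, mul_comm]
    · rw [orbitBasis_apply_of_ne hv, h0 v w (r.trans (r.symm y.2) v.2)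
        (Or.inl fun h => hv (Subtype.ext h)), mul_zero, zero_mul]
  · intro w' hw'
    by_contra hne
    exact hw' (h0 v w' (r.trans (r.symm y.2) v.2)
      (Or.inr fun h => hne (Finset.mem_singleton.2 (Subtype.ext h))))

variable [LocallyCompactSpace X]

/-- The regular representations are irreducible, since `C_c(R)` has all matrix units. -/
noncomputable def regRep (hr : IsEtaleRel r) (x : X) : IrreducibleRep (GroupoidCStar r hr) where
  H := OrbitSpace r x
  π := reg hr x
  exists_ne_zero := by
    obtain ⟨e, h1, h0⟩ := ConvAlg.exists_matrixUnit hr (r.refl x)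
    refine ⟨ofConv e, fun h => one_ne_zero (α := ℂ) ?_⟩
    rw [← h1, ← reg_ofConv_orbitBasis (x := x) e ⟨x, r.refl x⟩ ⟨x, r.refl x⟩, h]
    rfl
  irreducible K hK hinv := by
    rw [or_iff_not_imp_left]
    intro hne
    obtain ⟨ξ, hξ, hξ0⟩ := K.exists_mem_ne_zero_of_ne_bot hne
    obtain ⟨w, hw⟩ : ∃ w, ξ w ≠ 0 := by
      by_contra! h
      exact hξ0 (by ext i; exact h i)
    have hb : ∀ y : {y // r x y}, orbitBasis y ∈ K := by
      intro y
      obtain ⟨e, h1, h0⟩ := ConvAlg.exists_matrixUnit hr (r.trans (r.symm y.2) w.2)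
      have h := hinv (ofConv e) ξ hξ
      rw [reg_ofConv_matrixUnit h1 h0] at h
      simpa [smul_smul, hw] using K.smul_mem (ξ w)⁻¹ h
    have : CompleteSpace K := hK.completeSpace_coe
    rw [← Submodule.orthogonal_eq_bot_iff, Submodule.eq_bot_iff]
    intro η hη
    ext y
    rw [← inner_orbitBasis]
    exact hη _ (hb y)

end GroupoidCStar

end RegularRepresentation

/-! ### Irreducible representations with a common vector state -/

namespace IrreducibleRep

variable {A : Type u} [NonUnitalCStarAlgebra A]

lemma continuous_π (ρ : IrreducibleRep A) : Continuous ρ.π :=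
  AddMonoidHomClass.continuous_of_bound ρ.π 1 fun a => by
    rw [one_mul]; exact NonUnitalStarAlgHom.norm_apply_le ρ.π a

/-- The map `a ↦ π(a) v`. -/
noncomputable def orbitMap (ρ : IrreducibleRep A) (v : ρ.H) : A →ₗ[ℂ] ρ.H where
  toFun a := ρ.π a v
  map_add' a b := by simp
  map_smul' c a := by simp

lemma orbitMap_apply (ρ : IrreducibleRep A) (v : ρ.H) (a : A) : ρ.orbitMap v a = ρ.π a v := rfl

/-- Every nonzero vector of an irreducible representation is cyclic. -/
lemma denseRange_orbitMap (ρ : IrreducibleRep A) {v : ρ.H} (hv : v ≠ 0) :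
    DenseRange (ρ.orbitMap v) := by
  set K := (LinearMap.range (ρ.orbitMap v)).topologicalClosure with hK
  have hKinv : ∀ a, ∀ w ∈ K, ρ.π a w ∈ K := by
    intro a w hw
    have h1 : MapsTo (ρ.π a) (LinearMap.range (ρ.orbitMap v)) (LinearMap.range (ρ.orbitMap v)) := by
      rintro _ ⟨b, rfl⟩
      exact ⟨a * b, by simp [orbitMap_apply]⟩
    exact h1.closure (ρ.π a).continuous hw
  rcases ρ.irreducible K (Submodule.isClosed_topologicalClosure _) hKinv with h | h
  · -- the common kernel of all `π(a)` is invariant and contains `v`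
    exfalso
    have hv0 : ∀ a, ρ.π a v = 0 := fun a => by
      have : ρ.orbitMap v a ∈ K := Submodule.le_topologicalClosure _ ⟨a, rfl⟩
      rwa [h, Submodule.mem_bot] at this
    set L : Submodule ℂ ρ.H := ⨅ a, LinearMap.ker (ρ.π a : ρ.H →ₗ[ℂ] ρ.H) with hL
    have hmem : ∀ w, w ∈ L ↔ ∀ a, ρ.π a w = 0 := fun w => by simp [hL]
    have hLc : IsClosed (L : Set ρ.H) := by
      have : (L : Set ρ.H) = ⋂ a, {w | ρ.π a w = 0} := by
        ext w; simp [hmem]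
      rw [this]
      exact isClosed_iInter fun a => isClosed_eq (ρ.π a).continuous continuous_const
    have hLinv : ∀ a, ∀ w ∈ L, ρ.π a w ∈ L := fun a w hw => by
      rw [(hmem w).1 hw a]; exact L.zero_mem
    rcases ρ.irreducible L hLc hLinv with h' | h'
    · exact hv ((Submodule.eq_bot_iff _).1 h' v ((hmem v).2 hv0))
    · obtain ⟨a, ha⟩ := ρ.exists_ne_zero
      refine ha (ContinuousLinearMap.ext fun w => ?_)
      exact (hmem w).1 (h' ▸ Submodule.mem_top) a
  · rw [denseRange_iff_closure_range]
    exact congrArg (SetLike.coe : Submodule ℂ ρ.H → Set ρ.H) h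

lemma norm_sq_apply (ρ : IrreducibleRep A) (v : ρ.H) (a : A) :
    (‖ρ.π a v‖ : ℂ) ^ 2 = inner ℂ v (ρ.π (star a * a) v) := by
  rw [map_mul, map_star, ContinuousLinearMap.star_eq_adjoint, mul_apply_eq_comp,
    ContinuousLinearMap.adjoint_inner_right, inner_self_eq_norm_sq_to_K]
  rfl

/-- The uniqueness part of the Gelfand–Naimark–Segal construction: irreducible representations that
have nonzero vectors with the same matrix coefficient are unitarily equivalent. -/
lemma equiv_of_inner_eq (ρ σ : IrreducibleRep A) {v : ρ.H} {w : σ.H} (hv : v ≠ 0) (hw : w ≠ 0)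
    (h : ∀ a, inner ℂ v (ρ.π a v) = inner ℂ w (σ.π a w)) : IrreducibleRep.setoid A ρ σ := by
  have hnorm : ∀ a, ‖σ.orbitMap w (LinearEquiv.refl ℂ A a)‖ = ‖ρ.orbitMap v a‖ := by
    intro a
    rw [← sq_eq_sq₀ (norm_nonneg _) (norm_nonneg _)]
    have := (σ.norm_sq_apply w a).trans ((h _).symm.trans (ρ.norm_sq_apply v a).symm)
    exact_mod_cast this
  let U := (LinearEquiv.refl ℂ A).extendOfIsometry _ _ (ρ.denseRange_orbitMap hv)
    (σ.denseRange_orbitMap hw) hnorm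
  have hU : ∀ a, U (ρ.orbitMap v a) = σ.orbitMap w a := fun a =>
    LinearEquiv.extendOfIsometry_eq _ _ _ _ _ _ a
  refine ⟨U, fun a ξ => ?_⟩
  refine (ρ.denseRange_orbitMap hv).induction_on (p := fun ξ => U (ρ.π a ξ) = σ.π a (U ξ)) ξ
    (isClosed_eq (by fun_prop) (by fun_prop)) fun b => ?_
  rw [hU, orbitMap_apply, orbitMap_apply, ← mul_apply_eq_comp, ← map_mul,
    ← mul_apply_eq_comp, ← map_mul]
  exact hU (a * b)

end IrreducibleRep

/-! ### Classification of the irreducible representations of `C*(R)` -/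

section Classification

variable {X : Type u} [TopologicalSpace X] [T2Space X] {r : Setoid X} {hr : IsEtaleRel r}

namespace ConvAlg

lemma eq_diag {f : ConvAlg r hr} {h : C(X, ℂ)} {hc : HasCompactSupport h}
    (h1 : ∀ x, f.coeff x x = h x) (h2 : ∀ x y, x ≠ y → f.coeff x y = 0) : f = diag hr h hc := by
  refine ext_coeff fun x y => ?_
  by_cases hxy : x = y
  · subst hxy; rw [h1, coeff_diag_self]
  · rw [h2 x y hxy, coeff_diag_of_ne hxy]

/-- Where no two distinct points of `U` are equivalent, compression by functions that vanish off `U`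
turns all of `C_c(R)` into diagonal elements. -/
lemma diag_mul_mul_diag {U : Set X} (hU : ∀ y ∈ U, ∀ w ∈ U, r y w → y = w) (f : ConvAlg r hr)
    {h k g : C(X, ℂ)} {hc : HasCompactSupport h} {kc : HasCompactSupport k}
    {gc : HasCompactSupport g} (hhU : ∀ y ∉ U, h y = 0) (hkU : ∀ y ∉ U, k y = 0)
    (hg : ∀ y, g y = h y * f.coeff y y * k y) :
    diag hr h hc * f * diag hr k kc = diag hr g gc := by
  refine eq_diag (fun y => ?_) fun y w hyw => ?_
  · rw [coeff_mul_diag, coeff_diag_mul, hg]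
  · rw [coeff_mul_diag, coeff_diag_mul]
    by_cases hy : y ∈ U
    · by_cases hw : w ∈ U
      · rw [coeff_of_not_rel f fun h => hyw (hU y hy w hw h), mul_zero, zero_mul]
      · rw [hkU w hw, mul_zero]
    · rw [hhU y hy, zero_mul, zero_mul]

omit [T2Space X] in
lemma coeff_self_eq_toFun (f : ConvAlg r hr) :
    (fun y => f.coeff y y) = fun y => f.toFun ⟨(y, y), r.refl y⟩ :=
  funext fun y => f.coeff_of_rel (r.refl y)

omit [T2Space X] in
lemma continuous_coeff_self (f : ConvAlg r hr) : Continuous fun y => f.coeff y y := by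
  rw [coeff_self_eq_toFun]
  exact f.2.comp (by fun_prop)

variable [LocallyCompactSpace X]

/-- By a partition of unity, a representation that is locally zero on the diagonal is zero. -/
lemma map_eq_zero_of_locally {B : Type*} [NonUnitalRing B] (φ : ConvAlg r hr →+ B)
    (hφ : ∀ f g, φ (f * g) = φ f * φ g)
    (hloc : ∀ x, ∃ W, IsOpen W ∧ x ∈ W ∧ ∀ (h : C(X, ℂ)) (hc : HasCompactSupport h),
      tsupport h ⊆ W → φ (diag hr h hc) = 0) (f : ConvAlg r hr) : φ f = 0 := by
  choose W hWo hxW hW using hloc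
  have hK : IsCompact ((fun γ : RelGraph r => γ.1.1) '' tsupport f.toFun) :=
    f.3.isCompact.image (by fun_prop)
  obtain ⟨t, ht⟩ := hK.elim_finite_subcover W hWo fun x _ => mem_iUnion.2 ⟨x, hxW x⟩
  obtain ⟨χ, hχW, hχ1, -, hχc⟩ := exists_continuous_sum_one_of_isOpen_isCompact
    (s := fun i : Fin t.card => W (t.equivFin.symm i)) (fun i => hWo _) hK (by
      intro x hx
      obtain ⟨y, hy, hxy⟩ := mem_iUnion₂.1 (ht hx)
      exact mem_iUnion.2 ⟨t.equivFin ⟨y, hy⟩, by simpa using hxy⟩)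
  let χ' : Fin t.card → C(X, ℂ) := fun i => ⟨fun x => (χ i x : ℂ), by fun_prop⟩
  have hχ'c : ∀ i, HasCompactSupport (χ' i) := fun i =>
    (hχc i).comp_left (g := fun t : ℝ => (t : ℂ)) (by simp)
  have hχ'W : ∀ i, tsupport (χ' i) ⊆ W (t.equivFin.symm i) := fun i =>
    (closure_mono (Function.support_comp_subset (g := fun t : ℝ => (t : ℂ)) (by simp) _)).trans
      (hχW i)
  have hcoeff : ∀ (s : Finset (Fin t.card)) (x y : X),
      (∑ i ∈ s, diag hr (χ' i) (hχ'c i) * f).coeff x y = (∑ i ∈ s, χ' i x) * f.coeff x y := by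
    intro s x y
    induction s using Finset.cons_induction with
    | empty => simp
    | cons a s ha ih => rw [Finset.sum_cons, Finset.sum_cons, coeff_add, ih, coeff_diag_mul, add_mul]
  have hf : f = ∑ i, diag hr (χ' i) (hχ'c i) * f := by
    refine ext_coeff fun x y => ?_
    rw [hcoeff]
    by_cases hxy : f.coeff x y = 0
    · rw [hxy, mul_zero]
    · have hrel := rel_of_coeff_ne hxy
      have hx : x ∈ (fun γ : RelGraph r => γ.1.1) '' tsupport f.toFun := by
        refine ⟨⟨(x, y), hrel⟩, subset_tsupport _ ?_, rfl⟩
        rwa [Function.mem_support, toFun_eq]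
      have h1 : ∑ i, χ i x = 1 := by simpa using hχ1 hx
      have h2 : ∑ i, χ' i x = 1 := by
        change ∑ i, (χ i x : ℂ) = 1
        rw [← Complex.ofReal_sum, h1, Complex.ofReal_one]
      rw [h2, one_mul]
  rw [hf, map_sum]
  exact Finset.sum_eq_zero fun i _ => by rw [hφ, hW _ _ _ (hχ'W i), zero_mul]

end ConvAlg

namespace GroupoidCStar

open ConvAlg

variable [LocallyCompactSpace X]

/-- The point of `X` that carries an irreducible representation: no neighbourhood of it has all its
functions in the kernel. -/
lemma exists_support_point (ρ : IrreducibleRep (GroupoidCStar r hr)) :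
    ∃ x : X, ∀ W, IsOpen W → x ∈ W → ∃ (h : C(X, ℂ)) (hc : HasCompactSupport h),
      tsupport h ⊆ W ∧ ρ.π (ofConv (diag hr h hc)) ≠ 0 := by
  by_contra! hcon
  obtain ⟨a, ha⟩ := ρ.exists_ne_zero
  have hcont : Continuous ρ.π := ρ.continuous_π
  suffices h : ∀ a, ρ.π a = 0 from ha (h a)
  clear a ha
  intro a
  induction a using induction₁ with
  | hP => exact isClosed_eq hcont continuous_const
  | h f =>
    let φ : ConvAlg r hr →+ (ρ.H →L[ℂ] ρ.H) :=
      { toFun := fun f => ρ.π (ofConv f)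
        map_zero' := by rw [ofConv_zero, map_zero]
        map_add' := fun f g => by rw [ofConv_add, map_add] }
    exact map_eq_zero_of_locally φ (fun f g => by
      change ρ.π _ = ρ.π _ * ρ.π _
      rw [ofConv_mul, map_mul]) hcon f

/-- Near its support point, an irreducible representation only sees the value of a function at that
point. -/
lemma map_diag_eq_zero (ρ : IrreducibleRep (GroupoidCStar r hr)) {x : X}
    (hx : ∀ W, IsOpen W → x ∈ W → ∃ (h : C(X, ℂ)) (hc : HasCompactSupport h),
      tsupport h ⊆ W ∧ ρ.π (ofConv (diag hr h hc)) ≠ 0)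
    {U : Set X} (hUo : IsOpen U) (hxU : x ∈ U) (hU : ∀ y ∈ U, ∀ w ∈ U, r y w → y = w)
    {h : C(X, ℂ)} (hc : HasCompactSupport h) (hhU : ∀ y ∉ U, h y = 0) (h0 : h x = 0) :
    ρ.π (ofConv (diag hr h hc)) = 0 := by
  -- functions that vanish near `x` are orthogonal to functions that `ρ` does not kill
  have hnear : ∀ (h : C(X, ℂ)) (hc : HasCompactSupport h), (∀ y ∉ U, h y = 0) →
      (∀ᶠ y in 𝓝 x, h y = 0) → ρ.π (ofConv (diag hr h hc)) = 0 := by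
    intro h hc hhU hev
    obtain ⟨W, hW, hWo, hxW⟩ := eventually_nhds_iff.1 hev
    obtain ⟨k, kc, hkW, hk⟩ := hx (W ∩ U) (hWo.inter hUo) ⟨hxW, hxU⟩
    have hk0 : ∀ y ∉ W ∩ U, k y = 0 := fun y hy => by
      by_contra hne
      exact hy (hkW (subset_tsupport _ hne))
    obtain ⟨ξ, hξ⟩ : ∃ ξ, ρ.π (ofConv (diag hr k kc)) ξ ≠ 0 := by
      by_contra! hcon
      exact hk (ContinuousLinearMap.ext hcon)
    have hzero : ∀ a, ρ.π (ofConv (diag hr h hc)) * ρ.π a * ρ.π (ofConv (diag hr k kc)) = 0 := by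
      intro a
      have hcont : Continuous ρ.π := ρ.continuous_π
      induction a using induction₁ with
      | hP => exact isClosed_eq ((continuous_const.mul hcont).mul continuous_const) continuous_const
      | h f =>
        rw [← map_mul, ← map_mul, ← ofConv_mul, ← ofConv_mul,
          diag_mul_mul_diag (g := 0) (gc := HasCompactSupport.zero) hU f hhU
            (fun y hy => hk0 y fun h => hy h.2)]
        · have : diag hr (0 : C(X, ℂ)) HasCompactSupport.zero = 0 :=
            (eq_diag (fun x => by simp) fun x y _ => by simp).symm
          rw [this, ofConv_zero, map_zero]
        · intro y
          by_cases hy : y ∈ W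
          · rw [hW y hy]; simp
          · rw [hk0 y fun h => hy h.1]; simp
    refine ContinuousLinearMap.ext fun η => ?_
    refine (ρ.denseRange_orbitMap hξ).induction_on
      (p := fun η => ρ.π (ofConv (diag hr h hc)) η = 0) η
      (isClosed_eq (by fun_prop) continuous_const) fun a => ?_
    exact congrArg (fun T : ρ.H →L[ℂ] ρ.H => T ξ) (hzero a)
  rw [← norm_le_zero_iff]
  refine le_of_forall_pos_le_add fun ε hε => ?_
  rw [zero_add]
  -- cut `h` down to a neighbourhood of `x` where it is small
  have hW : {y | ‖h y‖ < ε} ∈ 𝓝 x :=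
    (isOpen_lt (by fun_prop) continuous_const).mem_nhds (by simpa [h0] using hε)
  obtain ⟨K, hKx, hKW, hK⟩ := local_compact_nhds hW
  obtain ⟨χ, hχ1, hχ0, hχc, hχI⟩ := exists_continuous_one_zero_of_isCompact hK
    (isClosed_le (f := fun _ => ε) (g := fun y => ‖h y‖) continuous_const (by fun_prop))
    (Set.disjoint_left.2 fun y hy hy' => (not_lt.2 (show ε ≤ ‖h y‖ from hy')) (hKW hy))
  let g : C(X, ℂ) := ⟨fun y => χ y * h y, by fun_prop⟩
  have gc : HasCompactSupport g := hc.mul_left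
  have hsub : HasCompactSupport (h - g) := hc.sub gc
  have hdec : diag hr h hc = diag hr g gc + diag hr (h - g) hsub := by
    refine (eq_diag (fun y => ?_) fun y w hyw => ?_).symm
    · rw [coeff_add, coeff_diag_self, coeff_diag_self]; simp
    · rw [coeff_add, coeff_diag_of_ne hyw, coeff_diag_of_ne hyw, add_zero]
  have hrest : ρ.π (ofConv (diag hr (h - g) hsub)) = 0 := by
    refine hnear _ _ (fun y hy => ?_) (Filter.mem_of_superset hKx fun y hy => ?_)
    · change h y - χ y * h y = 0
      simp [hhU y hy]
    · change h y - χ y * h y = 0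
      simp [hχ1 hy]
  rw [hdec, ofConv_add, map_add, hrest, add_zero]
  refine (NonUnitalStarAlgHom.norm_apply_le ρ.π _).trans ?_
  rw [norm_ofConv]
  refine norm_diag_le hε.le fun y => ?_
  change ‖(χ y : ℂ) * h y‖ ≤ ε
  have hχy := hχI y
  rw [norm_mul, Complex.norm_real, Real.norm_of_nonneg hχy.1]
  by_cases hy : ‖h y‖ < ε
  · exact (mul_le_of_le_one_left (norm_nonneg _) hχy.2).trans hy.le
  · have : χ y = 0 := hχ0 (not_lt.1 hy)
    rw [this, zero_mul]
    exact hε.le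

/-- Every irreducible representation of `C*(R)` has a unit vector whose matrix coefficient is the
evaluation `f ↦ f(x, x)` at some point `x`.  It is a vector in the range of the projection that
represents the functions with value `1` at `x`. -/
lemma exists_vector_state (ρ : IrreducibleRep (GroupoidCStar r hr)) :
    ∃ (x : X) (v : ρ.H), v ≠ 0 ∧ ∀ f : ConvAlg r hr,
      inner ℂ v (ρ.π (ofConv f) v) = f.coeff x x := by
  obtain ⟨x, hx⟩ := exists_support_point ρ
  obtain ⟨U, hUo, hxU, hU⟩ := hr.exists_isOpen_transversal x
  obtain ⟨e', he1, he0, hec, -⟩ := exists_continuous_one_zero_of_isCompact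
    (isCompact_singleton (x := x)) (isClosed_compl_iff.2 hUo) (by simpa using hxU)
  let e : C(X, ℂ) := ⟨fun y => (e' y : ℂ), by fun_prop⟩
  have ec : HasCompactSupport e := hec.comp_left (g := fun t : ℝ => (t : ℂ)) (by simp)
  have hex : e x = 1 := by
    have : e' x = 1 := he1 rfl
    change (e' x : ℂ) = 1
    rw [this, Complex.ofReal_one]
  have heU : ∀ y ∉ U, e y = 0 := fun y hy => by
    have : e' y = 0 := he0 hy
    change (e' y : ℂ) = 0
    rw [this, Complex.ofReal_zero]
  set P := ρ.π (ofConv (diag hr e ec)) with hP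
  have hdiag : ∀ (h : C(X, ℂ)) (hc : HasCompactSupport h), (∀ y ∉ U, h y = 0) →
      ρ.π (ofConv (diag hr h hc)) = h x • P := by
    intro h hc hhU
    have hsc : HasCompactSupport (h - h x • e) := hc.sub (ec.smul_left (f := fun _ => h x))
    have hdec : diag hr h hc = h x • diag hr e ec + diag hr (h - h x • e) hsc := by
      refine (eq_diag (fun y => ?_) fun y w hyw => ?_).symm
      · rw [coeff_add, coeff_smul, coeff_diag_self, coeff_diag_self]; simp
      · rw [coeff_add, coeff_smul, coeff_diag_of_ne hyw, coeff_diag_of_ne hyw, mul_zero, add_zero]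
    have h0 : ρ.π (ofConv (diag hr (h - h x • e) hsc)) = 0 :=
      map_diag_eq_zero ρ hx hUo hxU hU hsc (fun y hy => by simp [hhU y hy, heU y hy])
        (by simp [hex])
    rw [hdec, ofConv_add, map_add, h0, add_zero, ofConv_smul, map_smul]
  have hcomp : ∀ f : ConvAlg r hr, P * ρ.π (ofConv f) * P = f.coeff x x • P := by
    intro f
    let g : C(X, ℂ) := ⟨fun y => e y * f.coeff y y * e y, by
      have := f.continuous_coeff_self; fun_prop⟩
    have gc : HasCompactSupport g := ec.mul_left
    rw [hP, ← map_mul, ← map_mul, ← ofConv_mul, ← ofConv_mul,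
      diag_mul_mul_diag (g := g) (gc := gc) hU f heU heU fun y => rfl, hdiag g gc]
    · change (e x * f.coeff x x * e x) • P = _
      rw [hex, one_mul, mul_one]
    · intro y hy
      change e y * f.coeff y y * e y = 0
      rw [heU y hy, mul_zero]
  have hPne : P ≠ 0 := by
    obtain ⟨h, hc, hhU, hne⟩ := hx U hUo hxU
    intro hP0
    refine hne ?_
    rw [hdiag h hc, hP0, smul_zero]
    intro y hy
    by_contra hne
    exact hy (hhU (subset_tsupport _ hne))
  have hPstar : star P = P := by
    rw [hP, ← map_star, ← ofConv_star]
    congr 2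
    refine eq_diag (fun y => ?_) fun y w hyw => ?_
    · rw [coeff_star, coeff_diag_self]
      exact Complex.conj_ofReal _
    · rw [coeff_star, coeff_diag_of_ne hyw.symm, star_zero]
  have hPP : P * P = P := by
    have h2c : HasCompactSupport (e * e) := ec.mul_left
    have : diag hr e ec * diag hr e ec = diag hr (e * e) h2c := by
      refine eq_diag (fun y => ?_) fun y w hyw => ?_
      · rw [coeff_diag_mul, coeff_diag_self]; rfl
      · rw [coeff_diag_mul, coeff_diag_of_ne hyw, mul_zero]
    rw [hP, ← map_mul, ← ofConv_mul, this, hdiag _ _ fun y hy => by simp [heU y hy]]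
    simp [hex, hP]
  obtain ⟨ξ, hξ⟩ : ∃ ξ, P ξ ≠ 0 := by
    by_contra! hcon
    exact hPne (ContinuousLinearMap.ext hcon)
  set v := ((‖P ξ‖⁻¹ : ℝ) : ℂ) • P ξ with hv
  have hvn : ‖v‖ = 1 := by
    rw [hv, norm_smul, Complex.norm_real, norm_inv, norm_norm, inv_mul_cancel₀ (norm_ne_zero_iff.2 hξ)]
  have hPv : P v = v := by
    rw [hv, map_smul, ← mul_apply_eq_comp, hPP]
  refine ⟨x, v, fun h => by simp [h] at hvn, fun f => ?_⟩
  calc inner ℂ v (ρ.π (ofConv f) v) = inner ℂ (P v) (ρ.π (ofConv f) (P v)) := by rw [hPv]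
    _ = inner ℂ v ((star P * ρ.π (ofConv f) * P) v) := by
        rw [ContinuousLinearMap.star_eq_adjoint, mul_apply_eq_comp,
          mul_apply_eq_comp, ContinuousLinearMap.adjoint_inner_right]
    _ = inner ℂ v (f.coeff x x • v) := by
        rw [hPstar, hcomp, smul_apply, hPv]
    _ = f.coeff x x := by
        rw [inner_smul_right, inner_self_eq_norm_sq_to_K, hvn]
        simp

/-- An irreducible representation with a vector of matrix coefficient `f ↦ f(x, x)` is the regular
representation at `x`. -/
lemma equiv_regRep_of_vector_state (ρ : IrreducibleRep (GroupoidCStar r hr)) {x : X} {v : ρ.H}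
    (hv : v ≠ 0) (h : ∀ f : ConvAlg r hr, inner ℂ v (ρ.π (ofConv f) v) = f.coeff x x) :
    IrreducibleRep.setoid _ ρ (regRep hr x) := by
  have hx0 : (orbitBasis ⟨x, r.refl x⟩ : OrbitSpace r x) ≠ 0 := fun h0 => by
    have := norm_orbitBasis (⟨x, r.refl x⟩ : {y // r x y})
    rw [h0, norm_zero] at this
    exact zero_ne_one this
  refine ρ.equiv_of_inner_eq (regRep hr x) (w := orbitBasis ⟨x, r.refl x⟩) hv hx0 fun a => ?_
  have hcont : Continuous ρ.π := ρ.continuous_π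
  have hcont' : Continuous (regRep hr x).π := (regRep hr x).continuous_π
  induction a using induction₁ with
  | hP =>
    exact isClosed_eq (continuous_const.inner (hcont.clm_apply continuous_const))
      (continuous_const.inner (hcont'.clm_apply continuous_const))
  | h f =>
    rw [h f]
    change f.coeff x x = inner ℂ (orbitBasis (⟨x, r.refl x⟩ : {y // r x y}))
      (reg hr x (ofConv f) (orbitBasis ⟨x, r.refl x⟩))
    rw [inner_orbitBasis, reg_ofConv_orbitBasis]

/-- Every irreducible representation is equivalent to a regular representation. -/
lemma exists_equiv_regRep (ρ : IrreducibleRep (GroupoidCStar r hr)) :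
    ∃ x : X, IrreducibleRep.setoid _ ρ (regRep hr x) := by
  obtain ⟨x, v, hv, h⟩ := exists_vector_state ρ
  exact ⟨x, equiv_regRep_of_vector_state ρ hv h⟩

end GroupoidCStar

end Classification

/-! ### Representations by compact operators -/

namespace IrreducibleRep

variable {A : Type u} [NonUnitalCStarAlgebra A]

lemma apply_eq_zero_iff_of_equiv {ρ σ : IrreducibleRep A} (h : IrreducibleRep.setoid A ρ σ) (a : A) :
    ρ.π a = 0 ↔ σ.π a = 0 := by
  obtain ⟨U, hU⟩ := h
  constructor
  · intro h0
    refine ContinuousLinearMap.ext fun w => ?_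
    obtain ⟨v, rfl⟩ := U.surjective w
    rw [← hU, h0]; simp
  · intro h0
    refine ContinuousLinearMap.ext fun v => U.injective ?_
    rw [hU, h0]; simp

lemma isCompactOperator_of_equiv {ρ σ : IrreducibleRep A} (h : IrreducibleRep.setoid A ρ σ) {a : A}
    (ha : IsCompactOperator (σ.π a)) : IsCompactOperator (ρ.π a) := by
  obtain ⟨U, hU⟩ := h
  have h1 := (ha.comp_clm (U.toContinuousLinearEquiv : ρ.H →L[ℂ] σ.H)).continuous_comp
    U.symm.continuous
  convert! h1
  funext v
  exact (U.symm_apply_eq.2 (hU a v).symm).symm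

end IrreducibleRep

section SpectrumOfEtaleRelation

variable {X : Type u} [TopologicalSpace X] [T2Space X] [LocallyCompactSpace X] {r : Setoid X}
  {hr : IsEtaleRel r}

namespace IsEtaleRel

omit [T2Space X] [LocallyCompactSpace X] in
lemma finite_inter_orbit (hr : IsEtaleRel r) {K : Set X} (hK : IsCompact K) {x : X}
    (hx : IsClosed {y | r x y}) : (K ∩ {y | r x y}).Finite := by
  refine (hK.inter_right hx).finite (IsDiscrete.of_nhdsWithin fun y hy => ?_)
  obtain ⟨U, hU, hyU, h⟩ := hr.exists_isOpen_transversal y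
  rw [← Filter.principal_singleton, Filter.le_principal_iff]
  refine Filter.mem_of_superset
    (inter_mem (mem_nhdsWithin_of_mem_nhds (hU.mem_nhds hyU)) self_mem_nhdsWithin) ?_
  exact fun w hw => h _ hw.1 _ hyU (r.trans (r.symm hw.2.2) hy.2)

end IsEtaleRel

namespace GroupoidCStar

open ConvAlg

omit [LocallyCompactSpace X] in
/-- On a closed equivalence class, the elements of `C_c(R)` act by matrices with finitely many nonzero
rows. -/
lemma isCompactOperator_reg {x : X} (hx : IsClosed {y | r x y}) (a : GroupoidCStar r hr) :
    IsCompactOperator (reg hr x a) := by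
  have hcont : Continuous (reg hr x) := AddMonoidHomClass.continuous_of_bound (reg hr x) 1 fun a => by
    rw [one_mul]; exact NonUnitalStarAlgHom.norm_apply_le (reg hr x) a
  induction a using induction₁ with
  | hP => exact isClosed_setOfPred_isCompactOperator.preimage hcont
  | h f =>
    have hK : IsCompact ((fun γ : RelGraph r => γ.1.1) '' tsupport f.toFun) :=
      f.3.isCompact.image (by fun_prop)
    have hfin := (hr.finite_inter_orbit hK hx).preimage
      (Subtype.val_injective.injOn (s := (Subtype.val : {y // r x y} → X) ⁻¹' _))
    have hrow : ∀ y : {y // r x y}, y ∉ hfin.toFinset → ∀ w : X, f.coeff y w = 0 := by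
      intro y hy w
      by_contra hne
      refine hy (hfin.mem_toFinset.2 ⟨⟨⟨(y, w), rel_of_coeff_ne hne⟩, subset_tsupport _ ?_, rfl⟩, y.2⟩)
      rwa [Function.mem_support, toFun_eq]
    set T := reg hr x (ofConv f) with hT
    have hsum : T = ∑ y ∈ hfin.toFinset, InnerProductSpace.rankOne ℂ (orbitBasis y)
        (ContinuousLinearMap.adjoint T (orbitBasis y)) := by
      refine orbitSpace_ext fun v w => ?_
      rw [← inner_orbitBasis, ← inner_orbitBasis, sum_apply, inner_sum]
      simp_rw [InnerProductSpace.rankOne_apply, ContinuousLinearMap.adjoint_inner_left,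
        inner_smul_right, inner_orbitBasis]
      by_cases hv : v ∈ hfin.toFinset
      · rw [Finset.sum_eq_single v, orbitBasis_apply_self, mul_one]
        · intro y _ hy
          rw [orbitBasis_apply_of_ne hy.symm, mul_zero]
        · exact fun h => (h hv).elim
      · rw [Finset.sum_eq_zero, hT, reg_ofConv_orbitBasis, hrow v hv]
        intro y hy
        rw [orbitBasis_apply_of_ne, mul_zero]
        rintro rfl
        exact hv hy
    have hmem : T ∈ compactOperator (RingHom.id ℂ) (OrbitSpace r x) (OrbitSpace r x) := by
      rw [hsum]
      refine Submodule.sum_mem _ fun y _ => ?_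
      rw [InnerProductSpace.rankOne_def']
      exact (isCompactOperator_of_locallyCompactSpace_dom (innerSL ℂ _)).clm_comp
        (ContinuousLinearMap.toSpanSingleton ℂ (orbitBasis y))
    exact hmem

lemma isCCR (hcl : ∀ x, IsClosed {y | r x y}) : IsCCR (GroupoidCStar r hr) := by
  intro ρ a
  obtain ⟨x, hx⟩ := exists_equiv_regRep ρ
  exact IrreducibleRep.isCompactOperator_of_equiv hx (isCompactOperator_reg (hcl x) a)

/-! ### The spectrum of `C*(R)` -/

lemma regRep_equiv_of_rel {x y : X} (hxy : r x y) :
    IrreducibleRep.setoid _ (regRep hr x) (regRep hr y) := by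
  have hne : (orbitBasis ⟨y, hxy⟩ : OrbitSpace r x) ≠ 0 := fun h0 => by
    have := norm_orbitBasis (⟨y, hxy⟩ : {y // r x y})
    rw [h0, norm_zero] at this
    exact zero_ne_one this
  refine equiv_regRep_of_vector_state (regRep hr x) (v := orbitBasis ⟨y, hxy⟩) hne fun f => ?_
  change inner ℂ (orbitBasis (⟨y, hxy⟩ : {y // r x y}))
      (reg hr x (ofConv f) (orbitBasis ⟨y, hxy⟩)) = f.coeff y y
  rw [inner_orbitBasis, reg_ofConv_orbitBasis]

omit [LocallyCompactSpace X] in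
lemma reg_ofConv_diag_eq_zero_iff {x : X} {h : C(X, ℂ)} {hc : HasCompactSupport h} :
    reg hr x (ofConv (diag hr h hc)) = 0 ↔ ∀ y, r x y → h y = 0 := by
  constructor
  · intro h0 y hy
    have := reg_ofConv_orbitBasis (diag hr h hc) (⟨y, hy⟩ : {y // r x y}) ⟨y, hy⟩
    rw [h0, coeff_diag_self] at this
    exact this.symm
  · intro h0
    refine orbitSpace_ext fun y w => ?_
    rw [reg_ofConv_orbitBasis]
    by_cases hyw : y = w
    · rw [hyw, coeff_diag_self, h0 _ w.2]; rfl
    · rw [coeff_diag_of_ne fun h => hyw (Subtype.ext h)]; rfl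

/-- A function with value `1` at `x` that vanishes on a closed set that does not contain `x`. -/
lemma exists_bump {x : X} {C : Set X} (hC : IsClosed C) (hx : x ∉ C) :
    ∃ h : C(X, ℂ), HasCompactSupport h ∧ h x = 1 ∧ ∀ y ∈ C, h y = 0 := by
  obtain ⟨e, he1, he0, hec, -⟩ := exists_continuous_one_zero_of_isCompact
    (isCompact_singleton (x := x)) hC (by simpa using hx)
  refine ⟨⟨fun y => (e y : ℂ), by fun_prop⟩,
    hec.comp_left (g := fun t : ℝ => (t : ℂ)) (by simp), ?_, fun y hy => ?_⟩
  · simpa using he1 rfl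
  · simpa using he0 hy

lemma rel_of_regRep_equiv (hcl : ∀ x, IsClosed {y | r x y}) {x y : X}
    (h : IrreducibleRep.setoid _ (regRep hr x) (regRep hr y)) : r x y := by
  by_contra hxy
  obtain ⟨k, kc, hk1, hk0⟩ := exists_bump (hcl y) fun h => hxy (r.symm h)
  have h1 : reg hr y (ofConv (diag hr k kc)) = 0 := reg_ofConv_diag_eq_zero_iff.2 hk0
  have h2 : reg hr x (ofConv (diag hr k kc)) = 0 :=
    (IrreducibleRep.apply_eq_zero_iff_of_equiv h _).2 h1
  have := reg_ofConv_diag_eq_zero_iff.1 h2 x (r.refl x)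
  rw [hk1] at this
  exact one_ne_zero this

omit [LocallyCompactSpace X] in
/-- The diagonal matrix coefficients of an element of `C*(R)` are continuous on `X`: they are uniform
limits of the functions `x ↦ f(x, x)` for `f ∈ C_c(R)`. -/
lemma continuous_reg_diagonal (a : GroupoidCStar r hr) :
    Continuous fun x => reg hr x a (orbitBasis ⟨x, r.refl x⟩) ⟨x, r.refl x⟩ := by
  refine continuous_of_uniform_approx_of_continuous fun u hu => ?_
  obtain ⟨ε, hε, hεu⟩ := Metric.mem_uniformity_dist.1 hu
  obtain ⟨f, hf⟩ := denseRange_ofConv.exists_dist_lt a hε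
  refine ⟨fun x => f.coeff x x, f.continuous_coeff_self, fun x => hεu ?_⟩
  have hx : f.coeff x x = reg hr x (ofConv f) (orbitBasis ⟨x, r.refl x⟩) ⟨x, r.refl x⟩ :=
    (reg_ofConv_orbitBasis f (⟨x, r.refl x⟩ : {y // r x y}) ⟨x, r.refl x⟩).symm
  beta_reduce
  rw [hx, ← inner_orbitBasis, ← inner_orbitBasis, dist_eq_norm, ← inner_sub_right,
    ← sub_apply, ← map_sub]
  refine lt_of_le_of_lt ?_ (dist_eq_norm a (ofConv f) ▸ hf)
  calc _ ≤ ‖orbitBasis (⟨x, r.refl x⟩ : {y // r x y})‖ *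
        ‖reg hr x (a - ofConv f) (orbitBasis ⟨x, r.refl x⟩)‖ := norm_inner_le_norm _ _
    _ ≤ 1 * (‖reg hr x (a - ofConv f)‖ * 1) := by
        rw [norm_orbitBasis]
        gcongr
        simpa [norm_orbitBasis] using
          (reg hr x (a - ofConv f)).le_opNorm (orbitBasis ⟨x, r.refl x⟩)
    _ ≤ ‖a - ofConv f‖ := by
        rw [one_mul, mul_one]
        exact NonUnitalStarAlgHom.norm_apply_le (reg hr x) _

/-- The regular representations that do not vanish on an ideal form an open set: matrix units move a
nonzero matrix coefficient to the diagonal, where it is continuous. -/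
lemma isOpen_reg_ne_zero (J : TwoSidedIdeal (GroupoidCStar r hr)) :
    IsOpen {x : X | ∃ a ∈ J, reg hr x a ≠ 0} := by
  rw [isOpen_iff_mem_nhds]
  rintro x ⟨a, haJ, ha⟩
  obtain ⟨y, w, hyw⟩ : ∃ y w, reg hr x a (orbitBasis w) y ≠ 0 := by
    by_contra! hcon
    exact ha (orbitSpace_ext fun y w => by rw [hcon]; rfl)
  obtain ⟨e, he1, he0⟩ := exists_matrixUnit hr (y := x) (w := y) y.2
  obtain ⟨e', he1', he0'⟩ := exists_matrixUnit hr (y := w) (w := x) (r.symm w.2)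
  set x' : {y // r x y} := ⟨x, r.refl x⟩
  have hval : reg hr x (ofConv e * a * ofConv e') (orbitBasis x') x' =
      reg hr x a (orbitBasis w) y := by
    rw [map_mul, map_mul, mul_apply_eq_comp, mul_apply_eq_comp,
      reg_ofConv_matrixUnit (y := w) (w := x') he1' he0', orbitBasis_apply_self, one_smul,
      reg_ofConv_matrixUnit (y := x') (w := y) he1 he0, lp.coeFn_smul, Pi.smul_apply,
      orbitBasis_apply_self, smul_eq_mul, mul_one]
  have hmem : ofConv e * a * ofConv e' ∈ J := J.mul_mem_right _ _ (J.mul_mem_left _ _ haJ)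
  have hnhds := (continuous_reg_diagonal (ofConv e * a * ofConv e')).continuousAt.eventually_ne
    (hval.trans_ne hyw)
  refine Filter.mem_of_superset hnhds fun v hv => ⟨_, hmem, fun h0 => hv ?_⟩
  change reg hr v _ _ _ = 0
  rw [h0]
  rfl

variable (hr) in
/-- The map from the quotient space `X/R` to the spectrum of `C*(R)` that sends the class of `x` to
that of the regular representation at `x`. -/
noncomputable def toSpectrum : Quotient r → CStarSpectrum (GroupoidCStar r hr) :=
  Quotient.map (regRep hr) fun _ _ h => regRep_equiv_of_rel h

lemma bijective_toSpectrum (hcl : ∀ x, IsClosed {y | r x y}) :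
    Function.Bijective (toSpectrum hr) := by
  constructor
  · rintro ⟨x⟩ ⟨y⟩ h
    exact Quotient.sound (rel_of_regRep_equiv hcl (Quotient.exact h))
  · rintro ⟨ρ⟩
    obtain ⟨x, hx⟩ := exists_equiv_regRep ρ
    exact ⟨Quotient.mk r x, Quotient.sound ((IrreducibleRep.setoid _).symm hx)⟩

lemma toSpectrum_mem_iff (J : TwoSidedIdeal (GroupoidCStar r hr)) (x : X) :
    (∃ ρ : IrreducibleRep (GroupoidCStar r hr),
      Quotient.mk (IrreducibleRep.setoid _) ρ = toSpectrum hr (Quotient.mk r x) ∧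
        ∃ a ∈ J, ρ.π a ≠ 0) ↔ ∃ a ∈ J, reg hr x a ≠ 0 := by
  constructor
  · rintro ⟨ρ, hρ, a, haJ, ha⟩
    refine ⟨a, haJ, fun h0 => ha ?_⟩
    exact (IrreducibleRep.apply_eq_zero_iff_of_equiv (Quotient.exact hρ) a).2 h0
  · rintro ⟨a, haJ, ha⟩
    exact ⟨regRep hr x, rfl, a, haJ, ha⟩

lemma continuous_toSpectrum : Continuous (toSpectrum hr) := by
  rw [continuous_generateFrom_iff]
  rintro _ ⟨J, rfl⟩
  rw [← isQuotientMap_quotient_mk'.isOpen_preimage]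
  convert! isOpen_reg_ne_zero J
  ext x
  exact toSpectrum_mem_iff J x

/-- The open set of the spectrum that corresponds to an open set `V` of `X/R` belongs to the ideal of
all elements that are killed by the regular representations outside `V`. -/
lemma isOpenMap_toSpectrum (hcl : ∀ x, IsClosed {y | r x y}) : IsOpenMap (toSpectrum hr) := by
  intro V hV
  have hW : IsOpen {x | Quotient.mk r x ∈ V} := hV.preimage continuous_quotient_mk'
  let J : TwoSidedIdeal (GroupoidCStar r hr) :=
    ⨅ y : {y | Quotient.mk r y ∉ V}, TwoSidedIdeal.ker (reg hr (y : X))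
  have hJ : ∀ a, a ∈ J ↔ ∀ y, Quotient.mk r y ∉ V → reg hr y a = 0 := fun a => by
    simp [J, TwoSidedIdeal.mem_iInf, TwoSidedIdeal.mem_ker]
  refine TopologicalSpace.isOpen_generateFrom_of_mem ⟨J, ?_⟩
  ext q
  obtain ⟨p, rfl⟩ := (bijective_toSpectrum hcl).2 q
  obtain ⟨x, rfl⟩ := Quotient.exists_rep p
  refine Iff.trans ?_ (toSpectrum_mem_iff J x).symm
  rw [(bijective_toSpectrum hcl).1.mem_set_image]
  constructor
  · intro hx
    obtain ⟨h, hc, h1, h0⟩ := exists_bump (x := x) hW.isClosed_compl (fun h => h hx)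
    refine ⟨ofConv (diag hr h hc), (hJ _).2 fun y hy => ?_, fun hzero => ?_⟩
    · refine reg_ofConv_diag_eq_zero_iff.2 fun w hw => h0 w fun hwV => hy ?_
      rwa [mem_ofPred, ← Quotient.sound hw] at hwV
    · have := reg_ofConv_diag_eq_zero_iff.1 hzero x (r.refl x)
      rw [h1] at this
      exact one_ne_zero this
  · rintro ⟨a, haJ, ha⟩
    by_contra hx
    exact ha ((hJ a).1 haJ x hx)

/-- If `R` is étale in the topology of `X × X` and has closed equivalence classes, then the spectrum
of `C*(R)` is the quotient space `X/R`. -/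
noncomputable def spectrumHomeomorph (hr : IsEtaleRel r) (hcl : ∀ x, IsClosed {y | r x y}) :
    Quotient r ≃ₜ CStarSpectrum (GroupoidCStar r hr) :=
  (Equiv.ofBijective (toSpectrum hr) (bijective_toSpectrum hcl)).toHomeomorphOfContinuousOpen
    continuous_toSpectrum (isOpenMap_toSpectrum hcl)

end GroupoidCStar

/-! ### Separability -/

namespace ConvAlg

omit [LocallyCompactSpace X]

/-- The pointwise product of `e ∈ C_c(R)` with a continuous function on the graph. -/
noncomputable def pointwiseMul (e : ConvAlg r hr) (g : C(RelGraph r, ℂ)) : ConvAlg r hr :=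
  ⟨fun γ => g γ * e.toFun γ, by have := e.2; fun_prop, e.3.mul_left⟩

/-- Multiplication by `e` is continuous from the topology of uniform convergence on compact sets to
the norm of `C*(R)`, since its `I`-norm is bounded by the supremum over the support of `e`. -/
lemma continuous_pointwiseMul (e : ConvAlg r hr) : Continuous (pointwiseMul e) := by
  rw [continuous_iff_continuousAt]
  intro g₀
  rw [ContinuousAt, Metric.tendsto_nhds]
  intro ε hε
  have hδ : 0 < ε / (INorm e + 1) := div_pos hε (by have := e.INorm_nonneg; linarith)
  have h1 := (ContinuousMap.tendsto_iff_forall_isCompact_tendstoUniformlyOn.1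
    (tendsto_id (α := C(RelGraph r, ℂ)) (x := 𝓝 g₀))) _ e.3.isCompact
  filter_upwards [Metric.tendstoUniformlyOn_iff.1 h1 _ hδ] with g hg
  have hle : INorm (pointwiseMul e g - pointwiseMul e g₀) ≤ ε / (INorm e + 1) * INorm e := by
    refine INorm_le_of_norm_coeff_le hδ.le fun x y => ?_
    by_cases hxy : r x y
    · rw [sub_eq_add_neg, coeff_add, coeff_neg, coeff_of_rel _ hxy, coeff_of_rel _ hxy,
        coeff_of_rel _ hxy]
      set γ : RelGraph r := ⟨(x, y), hxy⟩
      change ‖g γ * e.toFun γ + -(g₀ γ * e.toFun γ)‖ ≤ _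
      rw [← sub_eq_add_neg, ← sub_mul, norm_mul]
      by_cases hγ : e.toFun γ = 0
      · simp [hγ]
      · have := hg γ (subset_tsupport _ hγ)
        rw [dist_comm, dist_eq_norm] at this
        gcongr
        exact this.le
    · simp [coeff_of_not_rel _ hxy, sub_eq_add_neg]
  rw [dist_eq_norm]
  refine (norm_le_INorm _).trans_lt (hle.trans_lt ?_)
  rw [div_mul_eq_mul_div, div_lt_iff₀ (by have := e.INorm_nonneg; linarith)]
  gcongr
  linarith

end ConvAlg

namespace GroupoidCStar

open ConvAlg

/-- `C_c(R)` is a countable union of images of the separable space of all continuous functions on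
the graph, under multiplication by functions that are `1` on the members of an exhaustion by compact
sets. -/
lemma separableSpace [SecondCountableTopology X] :
    TopologicalSpace.SeparableSpace (GroupoidCStar r hr) := by
  have := hr.locallyCompactSpace_relGraph
  have : SecondCountableTopology (RelGraph r) := IsEmbedding.subtypeVal.secondCountableTopology
  let K := CompactExhaustion.choice (RelGraph r)
  have hbump : ∀ n, ∃ e : ConvAlg r hr, ∀ γ ∈ K n, e.toFun γ = 1 := by
    intro n
    obtain ⟨χ, hχ1, -, hχc, -⟩ := exists_continuous_one_zero_of_isCompact (K.isCompact n)
      isClosed_empty (disjoint_empty _)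
    refine ⟨⟨fun γ => (χ γ : ℂ), by fun_prop,
      hχc.comp_left (g := fun t : ℝ => (t : ℂ)) (by simp)⟩, fun γ hγ => ?_⟩
    simpa using hχ1 hγ
  choose e he using hbump
  have hsep : TopologicalSpace.IsSeparable (⋃ n, Set.range (pointwiseMul (e n))) :=
    .iUnion fun n => TopologicalSpace.isSeparable_range (continuous_pointwiseMul (e n))
  have huniv : (⋃ n, Set.range (pointwiseMul (e n))) = univ := by
    refine eq_univ_of_forall fun f => ?_
    obtain ⟨n, hn⟩ := K.exists_superset_of_isCompact f.3.isCompact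
    refine mem_iUnion.2 ⟨n, ⟨f.toFun, f.2⟩, ext_coeff fun x y => ?_⟩
    by_cases hxy : r x y
    · rw [coeff_of_rel _ hxy, coeff_of_rel _ hxy]
      change f.toFun _ * (e n).toFun _ = _
      by_cases h0 : f.toFun ⟨(x, y), hxy⟩ = 0
      · rw [h0, zero_mul]
      · rw [he n _ (hn (subset_tsupport _ h0)), mul_one]
    · rw [coeff_of_not_rel _ hxy, coeff_of_not_rel _ hxy]
  have : TopologicalSpace.SeparableSpace (ConvAlg r hr) := by
    rw [← TopologicalSpace.isSeparable_univ_iff, ← huniv]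
    exact hsep
  exact UniformSpace.Completion.separableSpace_completion

end GroupoidCStar

end SpectrumOfEtaleRelation

/-! ### The C*-algebra of the example -/

section ExampleSpectrum

variable {Z : Type u} {z : ℕ → Z} [TopologicalSpace Z]

lemma isClosed_orbit_exampleSetoid [T1Space Z] (x : Z × ℕ) :
    IsClosed {y | exampleSetoid z x y} := by
  have : {y | exampleSetoid z x y} =
      {x.1} ×ˢ {j | (x.1, (x.2, j)) ∈ exampleRel z} := by
    ext ⟨b, j⟩
    exact and_congr_left' eq_comm
  rw [this]
  exact isClosed_singleton.prod (isClosed_discrete _)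

lemma nonempty_quotient_homeomorph [T2Space Z] (hdense : DenseRange z)
    (hiso : ∀ n, ¬ IsOpen ({z n} : Set Z)) :
    Nonempty (Quotient (exampleSetoid z) ≃ₜ ExampleSpace z) := by
  have : exampleSetoid z = Setoid.ker (exampleMap z) :=
    Setoid.ext fun x y => (exampleMap_eq_iff x y).symm
  rw [this]
  have hq := isQuotientMap_exampleMap hdense hiso
  exact ⟨IsQuotientMap.homeomorph (f := ⟨exampleMap z, hq.continuous⟩) hq⟩

end ExampleSpectrum

theorem mainTheorem2 {Z : Type u} [TopologicalSpace Z] [T2Space Z] [LocallyCompactSpace Z]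
    (z : ℕ → Z) (hdense : DenseRange z) (hiso : ∀ n, ¬ IsOpen ({z n} : Set Z)) :
    -- `R` is open in `Z × (ℕ × ℕ)`, and `(a, (i, j)) ↦ ((a, i), (a, j))` identifies it, as a
    -- topological space, with the graph of an equivalence relation on `Z × ℕ`
    IsOpen (exampleRel z) ∧
    IsEmbedding (fun p : exampleRel z => ((p.1.1, p.1.2.1), (p.1.1, p.1.2.2))) ∧
    Set.range (fun p : exampleRel z => ((p.1.1, p.1.2.1), (p.1.1, p.1.2.2))) =
      {q | exampleSetoid z q.1 q.2} ∧
    -- `Y = Z ⊔ ℕ` is the quotient space of `Z × ℕ` by `R`, with the topology described by a base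
    IsQuotientMap (exampleMap z) ∧
    (∀ x y, exampleMap z x = exampleMap z y ↔ exampleSetoid z x y) ∧
    TopologicalSpace.IsTopologicalBasis {V | ∃ (U : Set Z) (F : Finset ℕ), IsOpen U ∧ (∀ i ∈ F, z i ∈ U) ∧
      V = replacePoints z U F} ∧
    -- `Y` is locally compact; its Hausdorff points and their interior
    LocallyCompactHausdorff (ExampleSpace z) ∧
    hausdorffPoints (ExampleSpace z) = (Sum.inl '' (Set.range z)ᶜ : Set (Z ⊕ ℕ)) ∧
    interior (hausdorffPoints (ExampleSpace z)) = ∅ ∧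
    -- `R` is étale, and its C*-algebra is CCR with spectrum `Y`, and separable if `Z` is second
    -- countable
    ∃ hR : IsEtaleRel (exampleSetoid z),
      IsCCR (GroupoidCStar (exampleSetoid z) hR) ∧
      Nonempty (CStarSpectrum (GroupoidCStar (exampleSetoid z) hR) ≃ₜ ExampleSpace z) ∧
      (SecondCountableTopology Z →
        TopologicalSpace.SeparableSpace (GroupoidCStar (exampleSetoid z) hR)) := by
  obtain ⟨e⟩ := nonempty_quotient_homeomorph hdense hiso
  exact ⟨isOpen_exampleRel, isEmbedding_exampleRel, range_exampleRel,
    isQuotientMap_exampleMap hdense hiso, exampleMap_eq_iff,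
    isTopologicalBasis_replacePoints hdense hiso,
    locallyCompactHausdorff_exampleSpace hdense hiso, hausdorffPoints_exampleSpace hdense hiso,
    interior_hausdorffPoints_exampleSpace hdense hiso, isEtaleRel_exampleSetoid,
    GroupoidCStar.isCCR isClosed_orbit_exampleSetoid,
    ⟨(GroupoidCStar.spectrumHomeomorph _ isClosed_orbit_exampleSetoid).symm.trans e⟩,
    fun _ => GroupoidCStar.separableSpace⟩
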